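/- Fix a Grothendieck universe; categories have small Hom-sets. Let $\mathcal{A}$ be either a locally noetherian Grothendieck category (a Grothendieck category with a small generating set of noetherian objects) or a noetherian abelian category (a skeletally small abelian category all of whose objects are noetherian). Definitions. A nonzero object $H\in\mathcal{A}$ is *monoform* if there are no subobjects $0\neq L'\subsetneq L\subset H$ and $0\neq N\subset H$ with $L/L'\cong N$. Two monoform objects are *atom-equivalent* if they have isomorphic nonzero subobjects. This is an equivalence relation, and $\operatorname{ASpec}\mathcal{A}$ is the collection of its classes $\overline{H}$, called *atoms*. For $M\in\mathcal{A}$, $\operatorname{ASupp}M$ is the set of atoms $\overline{H}$ with $H$ a monoform subquotient of $M$. Fix a monoform representative of each atom; let $H$ be that of $\alpha$ and $K$ that of $\beta$. For an integer $i\geq 0$ and $N\in\mathcal{A}$ put $$\operatorname{Ext}^i_{\mathcal{A}}(\alpha,N):=\varinjlim_{0\neq H'\subset H}\operatorname{Ext}^i_{\mathcal{A}}(H',N),\qquad k(\alpha):=\varinjlim_{0\neq H'\subset H}\operatorname{Hom}_{\mathcal{A}}(H',H).$$ Composition makes $k(\alpha)$ a ring (in fact a skew field) and $\operatorname{Ext}^i_{\mathcal{A}}(\alpha,N)$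 a right $k(\alpha)$-module, functorially in $N$. Let $D_\alpha:=\operatorname{Hom}_{k(\alpha)}(-,k(\alpha))$ on right $k(\alpha)$-modules. The *virtual dual* of $\operatorname{Ext}^i_{\mathcal{A}}(\alpha,\beta)$ is $$\operatorname{DExt}^i_{\mathcal{A}}(\alpha,\beta):=\varinjlim_{0\neq K'\subset K}D_\alpha\operatorname{Ext}^i_{\mathcal{A}}(\alpha,K').$$ The *global dimension* of $\mathcal{A}$ is $\operatorname{gl.dim}\mathcal{A}:=\sup\{i\geq 0\mid \operatorname{Ext}^i_{\mathcal{A}}(M,N)\neq 0\text{ for some }M,N\in\mathcal{A}\}$, where the supremum of the empty set is $-1$ and the supremum of an unbounded set is $\infty$. Then the following hold. 1. Let $i\geq 0$, $\alpha\in\operatorname{ASpec}\mathcal{A}$ and $N\in\mathcal{A}$. If $\operatorname{Ext}^i_{\mathcal{A}}(\alpha,N)\neq 0$, then there exists $\beta\in\operatorname{ASupp}N$ such that $\operatorname{DExt}^i_{\mathcal{A}}(\alpha,\beta)\neq 0$. 2. Let $i\geq 0$ and $M,N\in\mathcal{A}$. If $\operatorname{Ext}^i_{\mathcal{A}}(M,N)\neq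 0$, then there exist $\alpha\in\operatorname{ASupp}M$ and $\beta\in\operatorname{ASupp}N$ such that $\operatorname{DExt}^i_{\mathcal{A}}(\alpha,\beta)\neq 0$. 3. We have $$\operatorname{gl.dim}\mathcal{A}=\sup\{i\geq 0\mid \operatorname{DExt}^i_{\mathcal{A}}(\alpha,\beta)\neq 0\text{ for some }\alpha,\beta\in\operatorname{ASpec}\mathcal{A}\}.$$ -/

import Mathlib

open CategoryTheory CategoryTheory.Limits Opposite

universe w v u

noncomputable section

namespace AtomSpectrum

variable {A : Type u} [Category.{v} A] [Abelian A]

/-- `H` is monoform: it is nonzero, and there are no subobjects `0 ≠ L' ⊊ L ⊆ H` and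
`0 ≠ N ⊆ H` such that `L / L' ≅ N`. -/
structure IsMonoform (H : A) : Prop where
  not_isZero : ¬ IsZero H
  isEmpty_iso : ∀ (L' L : Subobject H) (hL : L' < L), L' ≠ ⊥ →
    ∀ N : Subobject H, N ≠ ⊥ → IsEmpty (cokernel (Subobject.ofLE L' L hL.le) ≅ (N : A))

lemma subobject_eq_bot_iff {X : A} (S : Subobject X) : S = ⊥ ↔ S.arrow = 0 := by
  constructor
  · rintro rfl
    simp
  · intro h
    rw [← Subobject.mk_arrow S]
    exact Subobject.mk_eq_bot_iff_zero.2 h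

/-- Monoform objects are uniform. -/
lemma IsMonoform.inf_ne_bot {H : A} (hH : IsMonoform H) {S T : Subobject H}
    (hS : S ≠ ⊥) (hT : T ≠ ⊥) : S ⊓ T ≠ ⊥ := by
  intro hST
  have key : ∀ {W : A} (a : W ⟶ (S : A)) (b : W ⟶ (T : A)),
      a ≫ S.arrow = b ≫ T.arrow → a ≫ S.arrow = 0 := by
    intro W a b hab
    have h1 : (S ⊓ T).Factors (a ≫ S.arrow) := by
      rw [Subobject.inf_factors]
      exact ⟨Subobject.factors_comp_arrow a, hab ▸ Subobject.factors_comp_arrow b⟩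
    rw [hST] at h1
    exact (Subobject.bot_factors_iff_zero _).1 h1
  let d : (S : A) ⊞ (T : A) ⟶ H := biprod.desc S.arrow T.arrow
  have hd : Mono d := by
    refine Preadditive.mono_of_cancel_zero _ fun x hx => ?_
    have hx' : (x ≫ biprod.fst) ≫ S.arrow = (-(x ≫ biprod.snd)) ≫ T.arrow := by
      have : x ≫ d = (x ≫ biprod.fst) ≫ S.arrow + (x ≫ biprod.snd) ≫ T.arrow := by
        simp [d, biprod.desc_eq]
      rw [hx] at this
      rw [Preadditive.neg_comp]
      exact eq_neg_of_add_eq_zero_left this.symm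
    have h1 := key _ _ hx'
    have h2 : (-(x ≫ biprod.snd)) ≫ T.arrow = 0 := hx' ▸ h1
    apply biprod.hom_ext
    · rw [zero_comp]
      exact (cancel_mono S.arrow).1 (by rw [h1, zero_comp])
    · rw [zero_comp]
      exact neg_eq_zero.1 ((cancel_mono T.arrow).1 (by rw [h2, zero_comp]))
  have hSL : S ≤ Subobject.mk d := Subobject.le_mk_of_comm biprod.inl (by simp [d])
  have hTL : T ≤ Subobject.mk d := Subobject.le_mk_of_comm biprod.inr (by simp [d])
  have hlt : S < Subobject.mk d := by
    refine lt_of_le_of_ne hSL fun h => hT ?_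
    rw [← hST, right_eq_inf]
    exact hTL.trans h.ge
  refine (hH.isEmpty_iso S _ hlt hS T hT).false ?_
  exact cokernel.mapIso _ (biprod.inl : (S : A) ⟶ (S : A) ⊞ (T : A)) (Iso.refl _)
    (Subobject.underlyingIso d) (by
      apply (cancel_mono d).1
      simp [d]) ≪≫ cokernelBiprodInlIso

variable (A) in
/-- A monoform object of `A`. -/
structure MonoformObj where
  obj : A
  isMonoform : IsMonoform obj

/-- Two monoform objects are atom-equivalent if they have isomorphic nonzero subobjects. -/
def AtomEquivalent (H₁ H₂ : MonoformObj A) : Prop :=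
  ∃ (L₁ : Subobject H₁.obj) (L₂ : Subobject H₂.obj), L₁ ≠ ⊥ ∧ L₂ ≠ ⊥ ∧ Nonempty ((L₁ : A) ≅ (L₂ : A))

lemma top_ne_bot_of_isMonoform {H : A} (hH : IsMonoform H) : (⊤ : Subobject H) ≠ ⊥ := by
  have := Subobject.nontrivial_of_not_isZero hH.not_isZero
  exact top_ne_bot

lemma atomEquivalent_trans {H₁ H₂ H₃ : MonoformObj A} (h₁₂ : AtomEquivalent H₁ H₂)
    (h₂₃ : AtomEquivalent H₂ H₃) : AtomEquivalent H₁ H₃ := by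
  obtain ⟨L₁, L₂, -, h₂, ⟨e⟩⟩ := h₁₂
  obtain ⟨M₂, M₃, k₂, -, ⟨e'⟩⟩ := h₂₃
  have hne := H₂.isMonoform.inf_ne_bot h₂ k₂
  let a : ((L₂ ⊓ M₂ : Subobject H₂.obj) : A) ⟶ H₁.obj :=
    Subobject.ofLE _ _ inf_le_left ≫ e.inv ≫ L₁.arrow
  let b : ((L₂ ⊓ M₂ : Subobject H₂.obj) : A) ⟶ H₃.obj :=
    Subobject.ofLE _ _ inf_le_right ≫ e'.hom ≫ M₃.arrow
  have key : ∀ {X : A} (c : ((L₂ ⊓ M₂ : Subobject H₂.obj) : A) ⟶ X) [Mono c], c ≠ 0 := by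
    intro X c _ hc
    apply hne
    rw [subobject_eq_bot_iff]
    have : 𝟙 ((L₂ ⊓ M₂ : Subobject H₂.obj) : A) = 0 := (cancel_mono c).1 (by simp [hc])
    rw [← Category.id_comp (L₂ ⊓ M₂).arrow, this, zero_comp]
  exact ⟨Subobject.mk a, Subobject.mk b, fun h => key a (Subobject.mk_eq_bot_iff_zero.1 h),
    fun h => key b (Subobject.mk_eq_bot_iff_zero.1 h),
    ⟨Subobject.underlyingIso a ≪≫ (Subobject.underlyingIso b).symm⟩⟩

variable (A) in
/-- Atom-equivalence as an equivalence relation on monoform objects. -/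
def atomSetoid : Setoid (MonoformObj A) where
  r := AtomEquivalent
  iseqv :=
    { refl := fun H => ⟨⊤, ⊤, top_ne_bot_of_isMonoform H.isMonoform,
        top_ne_bot_of_isMonoform H.isMonoform, ⟨Iso.refl _⟩⟩
      symm := fun ⟨L₁, L₂, h₁, h₂, ⟨e⟩⟩ => ⟨L₂, L₁, h₂, h₁, ⟨e.symm⟩⟩
      trans := atomEquivalent_trans }

variable (A) in
/-- The atom spectrum of `A`. -/
def ASpec : Type u := Quotient (atomSetoid A)

/-- The atom represented by a monoform object. -/
def MonoformObj.atom (H : MonoformObj A) : ASpec A := Quotient.mk (atomSetoid A) H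

/-- `X` is a subquotient of `M`: it is isomorphic to `L / L'` for subobjects `L' ⊆ L ⊆ M`. -/
def IsSubquotient (X M : A) : Prop :=
  ∃ (L' L : Subobject M) (h : L' ≤ L), Nonempty (cokernel (Subobject.ofLE L' L h) ≅ X)

/-- The atom support of `M`. -/
def aSupp (M : A) : Set (ASpec A) :=
  {α | ∃ H : MonoformObj A, IsSubquotient H.obj M ∧ H.atom = α}

/-- The nonzero subobjects of `H`, directed by reverse inclusion. -/
@[ext]
structure NonzeroSub (H : A) where
  sub : Subobject H
  ne_bot : sub ≠ ⊥

instance (H : A) : Preorder (NonzeroSub H) where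
  le S T := T.sub ≤ S.sub
  le_refl S := le_refl S.sub
  le_trans _ _ _ h h' := le_trans (α := Subobject H) h' h

namespace NonzeroSub

/-- The inclusion of a smaller subobject into a larger one. -/
def incl {H : A} {S T : NonzeroSub H} (h : S ≤ T) : (T.sub : A) ⟶ (S.sub : A) :=
  Subobject.ofLE T.sub S.sub h

@[simp]
lemma incl_arrow {H : A} {S T : NonzeroSub H} (h : S ≤ T) :
    incl h ≫ S.sub.arrow = T.sub.arrow := Subobject.ofLE_arrow _

@[simp]
lemma incl_refl {H : A} (S : NonzeroSub H) : incl (le_refl S) = 𝟙 _ := Subobject.ofLE_refl _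

@[simp]
lemma incl_comp {H : A} {S T U : NonzeroSub H} (h : S ≤ T) (h' : T ≤ U) :
    incl h' ≫ incl h = incl (h.trans h') := Subobject.ofLE_comp_ofLE _ _ _ _ _

instance (H : MonoformObj A) : Nonempty (NonzeroSub H.obj) :=
  ⟨⟨⊤, top_ne_bot_of_isMonoform H.isMonoform⟩⟩

instance (H : MonoformObj A) : IsDirectedOrder (NonzeroSub H.obj) where
  directed S T := ⟨⟨S.sub ⊓ T.sub, H.isMonoform.inf_ne_bot S.ne_bot T.ne_bot⟩,
    inf_le_left (α := Subobject H.obj), inf_le_right (α := Subobject H.obj)⟩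

/-- A morphism from a nonzero subobject `T` of a monoform object `H` to `H` can be restricted to a
morphism from a smaller nonzero subobject to any given nonzero subobject `S`. -/
lemma exists_restrict {H : MonoformObj A} (S T : NonzeroSub H.obj) (f : (T.sub : A) ⟶ H.obj) :
    ∃ (W : NonzeroSub H.obj) (h : T ≤ W) (g : (W.sub : A) ⟶ (S.sub : A)),
      g ≫ S.sub.arrow = incl h ≫ f := by
  let P := (Subobject.pullback f).obj S.sub
  have hP : ∀ {X : A} (k : X ⟶ (T.sub : A)), S.sub.Factors (k ≫ f) → P.Factors k :=
    fun k hk => (Limits.pullback_factors_iff _ _ _).2 hk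
  have hne : P.arrow ≫ T.sub.arrow ≠ 0 := by
    intro h0
    have h1 : P.arrow = 0 := (cancel_mono T.sub.arrow).1 (by rw [h0, zero_comp])
    have h2 : ∀ {X : A} (k : X ⟶ (T.sub : A)), S.sub.Factors (k ≫ f) → k = 0 := by
      intro X k hk
      rw [← P.factorThru_arrow k (hP k hk), h1, comp_zero]
    have hf : Mono f := Preadditive.mono_of_cancel_zero _ fun k hk =>
      h2 k (by rw [hk]; exact Subobject.factors_zero)
    have hf0 : Subobject.mk f ≠ ⊥ := by
      intro h
      have h3 : f = 0 := Subobject.mk_eq_bot_iff_zero.1 h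
      have h4 : 𝟙 (T.sub : A) = 0 := h2 _ (by rw [h3, comp_zero]; exact Subobject.factors_zero)
      apply T.ne_bot
      rw [subobject_eq_bot_iff, ← Category.id_comp T.sub.arrow, h4, zero_comp]
    apply H.isMonoform.inf_ne_bot hf0 S.ne_bot
    rw [subobject_eq_bot_iff]
    obtain ⟨k, hk⟩ : ∃ k : ((Subobject.mk f ⊓ S.sub : Subobject H.obj) : A) ⟶ (T.sub : A),
        k ≫ f = (Subobject.mk f ⊓ S.sub).arrow :=
      ⟨Subobject.ofLE _ _ inf_le_left ≫ (Subobject.underlyingIso f).hom, by simp⟩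
    have h5 : k = 0 := h2 k (by
      rw [hk]
      exact Subobject.inf_arrow_factors_right (Subobject.mk f) S.sub)
    rw [← hk, h5, zero_comp]
  have hW : Subobject.mk (P.arrow ≫ T.sub.arrow) ≤ T.sub :=
    Subobject.mk_le_of_comm P.arrow rfl
  have hfac : S.sub.Factors (P.arrow ≫ f) :=
    (Limits.pullback_factors_iff _ _ _).1 (Subobject.factors_self P)
  refine ⟨⟨Subobject.mk (P.arrow ≫ T.sub.arrow),
    fun h => hne (Subobject.mk_eq_bot_iff_zero.1 h)⟩, hW,
    (Subobject.underlyingIso _).hom ≫ S.sub.factorThru _ hfac, ?_⟩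
  rw [Category.assoc, Subobject.factorThru_arrow, ← Category.assoc]
  congr 1
  apply (cancel_mono T.sub.arrow).1
  simp

end NonzeroSub


section Limit

variable (H : MonoformObj A) (F G : Aᵒᵖ ⥤ AddCommGrpCat.{w})

/-- The restriction maps `F S → F T` for nonzero subobjects `T ⊆ S` of `H`. -/
def restr {H : MonoformObj A} (S T : NonzeroSub H.obj) (h : S ≤ T) :
    F.obj (op (S.sub : A)) →+ F.obj (op (T.sub : A)) :=
  (F.map (NonzeroSub.incl h).op).hom

instance : DirectedSystem (fun S : NonzeroSub H.obj => F.obj (op (S.sub : A)))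
    (fun S T h => restr F S T h) where
  map_self S x := by simp [restr]
  map_map U T S h h' x := by
    simp only [restr]
    rw [← NonzeroSub.incl_comp h h', op_comp, F.map_comp]
    rfl

/-- The value of a contravariant functor `F` at the atom represented by `H`: the direct limit of
`F H'` over all nonzero subobjects `H'` of `H`. -/
def Value : Type (max u v w) :=
  DirectLimit (fun S : NonzeroSub H.obj => F.obj (op (S.sub : A))) (restr F)

instance : AddCommGroup (Value H F) :=
  inferInstanceAs (AddCommGroup
    (DirectLimit (fun S : NonzeroSub H.obj => F.obj (op (S.sub : A))) (restr F)))

namespace Value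

variable {H F G}

/-- The canonical map `F S → F(α)`. -/
def mk (S : NonzeroSub H.obj) (x : F.obj (op (S.sub : A))) : Value H F :=
  Quotient.mk (DirectLimit.setoid (restr F)) ⟨S, x⟩

lemma mk_surj (z : Value H F) : ∃ S x, z = mk (F := F) S x := by
  obtain ⟨⟨S, x⟩⟩ := z
  exact ⟨S, x, rfl⟩

lemma mk_eq_iff {S T : NonzeroSub H.obj} {x : F.obj (op (S.sub : A))}
    {y : F.obj (op (T.sub : A))} :
    mk S x = mk T y ↔ ∃ (U : NonzeroSub H.obj) (h : S ≤ U) (h' : T ≤ U),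
      F.map (NonzeroSub.incl h).op x = F.map (NonzeroSub.incl h').op y :=
  Quotient.eq (r := DirectLimit.setoid (restr F))

lemma mk_restrict {S T : NonzeroSub H.obj} (h : S ≤ T) (x : F.obj (op (S.sub : A))) :
    mk T (F.map (NonzeroSub.incl h).op x) = mk S x :=
  mk_eq_iff.2 ⟨T, le_refl T, h, by simp⟩

lemma mk_add (S : NonzeroSub H.obj) (x y : F.obj (op (S.sub : A))) :
    mk S (x + y) = mk S x + mk S y :=
  (DirectLimit.add_def (G := fun S : NonzeroSub H.obj => F.obj (op (S.sub : A)))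
    (f := restr F) S x y).symm

lemma mk_zero (S : NonzeroSub H.obj) : mk S (0 : F.obj (op (S.sub : A))) = 0 :=
  (DirectLimit.zero_def (G := fun S : NonzeroSub H.obj => F.obj (op (S.sub : A)))
    (f := restr F) S).symm

lemma mk_surj₂ (z z' : Value H F) : ∃ S x y, z = mk (F := F) S x ∧ z' = mk (F := F) S y := by
  obtain ⟨S, x, rfl⟩ := mk_surj z
  obtain ⟨T, y, rfl⟩ := mk_surj z'
  obtain ⟨U, h, h'⟩ := exists_ge_ge S T
  exact ⟨U, _, _, (mk_restrict h x).symm, (mk_restrict h' y).symm⟩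

/-- A natural transformation induces a map on the values at an atom. -/
def map (τ : F ⟶ G) : Value H F →+ Value H G where
  toFun := DirectLimit.map (restr F) (restr G) (fun S => τ.app (op (S.sub : A)))
    (fun S T h x => (NatTrans.naturality_apply τ (NonzeroSub.incl h).op x).symm)
  map_zero' := by
    obtain ⟨S⟩ : Nonempty (NonzeroSub H.obj) := inferInstance
    rw [← mk_zero S]
    change mk S (τ.app _ 0) = _
    rw [map_zero, mk_zero]
  map_add' z z' := by
    obtain ⟨S, x, y, rfl, rfl⟩ := mk_surj₂ z z'
    rw [← mk_add]
    change mk S (τ.app _ (x + y)) = mk S (τ.app _ x) + mk S (τ.app _ y)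
    rw [map_add, mk_add]

@[simp]
lemma map_mk (τ : F ⟶ G) (S : NonzeroSub H.obj) (x : F.obj (op (S.sub : A))) :
    map τ (mk S x) = mk S (τ.app _ x) := rfl

end Value

/-- The residue field `k(α) = Hom(α, H)` of the atom `α` represented by `H`. -/
def ResidueField : Type (max u v) := Value H (preadditiveYoneda.obj H.obj)

instance : AddCommGroup (ResidueField H) :=
  inferInstanceAs (AddCommGroup (Value H (preadditiveYoneda.obj H.obj)))

namespace ResidueField

variable {H}

/-- The class in `k(α)` of a morphism from a nonzero subobject of `H` to `H`. -/
def mk (S : NonzeroSub H.obj) (f : (S.sub : A) ⟶ H.obj) : ResidueField H :=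
  Value.mk (F := preadditiveYoneda.obj H.obj) S f

lemma mk_surj (z : ResidueField H) : ∃ S f, z = mk S f :=
  Value.mk_surj (F := preadditiveYoneda.obj H.obj) z

lemma mk_eq_iff {S T : NonzeroSub H.obj} {f : (S.sub : A) ⟶ H.obj}
    {g : (T.sub : A) ⟶ H.obj} :
    mk S f = mk T g ↔ ∃ (U : NonzeroSub H.obj) (h : S ≤ U) (h' : T ≤ U),
      NonzeroSub.incl h ≫ f = NonzeroSub.incl h' ≫ g :=
  Value.mk_eq_iff (F := preadditiveYoneda.obj H.obj)

lemma mk_restrict {S T : NonzeroSub H.obj} (h : S ≤ T) (f : (S.sub : A) ⟶ H.obj) :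
    mk T (NonzeroSub.incl h ≫ f) = mk S f :=
  Value.mk_restrict (F := preadditiveYoneda.obj H.obj) h f

lemma mk_add (S : NonzeroSub H.obj) (f g : (S.sub : A) ⟶ H.obj) :
    mk S (f + g) = mk S f + mk S g :=
  Value.mk_add (F := preadditiveYoneda.obj H.obj) S f g

lemma mk_zero (S : NonzeroSub H.obj) : mk S (0 : (S.sub : A) ⟶ H.obj) = 0 :=
  Value.mk_zero (F := preadditiveYoneda.obj H.obj) S

lemma mk_surj₂ (z z' : ResidueField H) : ∃ S f g, z = mk S f ∧ z' = mk S g :=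
  Value.mk_surj₂ (F := preadditiveYoneda.obj H.obj) z z'

end ResidueField

namespace Value

variable {H F G}

lemma restrict_unique {S S' T T' W W' : NonzeroSub H.obj} {x : F.obj (op (S.sub : A))}
    {x' : F.obj (op (S'.sub : A))} {f : (T.sub : A) ⟶ H.obj} {f' : (T'.sub : A) ⟶ H.obj}
    (hx : mk S x = mk S' x') (hf : ResidueField.mk T f = ResidueField.mk T' f')
    (h : T ≤ W) (h' : T' ≤ W') (g : (W.sub : A) ⟶ (S.sub : A)) (g' : (W'.sub : A) ⟶ (S'.sub : A))
    (hg : g ≫ S.sub.arrow = NonzeroSub.incl h ≫ f)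
    (hg' : g' ≫ S'.sub.arrow = NonzeroSub.incl h' ≫ f') :
    mk W (F.map g.op x) = mk W' (F.map g'.op x') := by
  obtain ⟨S₀, a, a', hS₀⟩ := mk_eq_iff.1 hx
  obtain ⟨T₀, b, b', hT₀⟩ := ResidueField.mk_eq_iff.1 hf
  obtain ⟨V, c, c'⟩ := exists_ge_ge W W'
  obtain ⟨V', d, d'⟩ := exists_ge_ge V T₀
  obtain ⟨U, e, p, hp⟩ := NonzeroSub.exists_restrict S₀ V'
    (NonzeroSub.incl d' ≫ NonzeroSub.incl b ≫ f)
  have h₁ : p ≫ NonzeroSub.incl a = NonzeroSub.incl ((c.trans d).trans e) ≫ g := by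
    apply (cancel_mono S.sub.arrow).1
    simp only [Category.assoc, NonzeroSub.incl_arrow, hp, hg]
    simp only [← Category.assoc, NonzeroSub.incl_comp]
  have h₂ : p ≫ NonzeroSub.incl a' = NonzeroSub.incl ((c'.trans d).trans e) ≫ g' := by
    apply (cancel_mono S'.sub.arrow).1
    simp only [Category.assoc, NonzeroSub.incl_arrow, hp, hg', hT₀]
    simp only [← Category.assoc, NonzeroSub.incl_comp]
  refine mk_eq_iff.2 ⟨U, (c.trans d).trans e, (c'.trans d).trans e, ?_⟩
  have e₁ : ∀ {X Y Z : A} (q : X ⟶ Y) (r : Y ⟶ Z) (y : F.obj (op Z)),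
      F.map q.op (F.map r.op y) = F.map (q ≫ r).op y := by
    intro X Y Z q r y
    simp
  rw [e₁, e₁, ← h₁, ← h₂, ← e₁, ← e₁, hS₀]

/-- The composition `F(α) × k(α) → F(α)`: the product of the classes of `x ∈ F(S)` and
`f : T ⟶ H` is the class of `g^* x`, where `g : W ⟶ S` is any restriction of `f` to a nonzero
subobject `W ⊆ T` with values in `S`. -/
def act (z : Value H F) (c : ResidueField H) : Value H F :=
  Quotient.liftOn₂ z c
    (fun x f => mk (NonzeroSub.exists_restrict x.1 f.1 f.2).choose
      (F.map (NonzeroSub.exists_restrict x.1 f.1 f.2).choose_spec.choose_spec.choose.op x.2))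
    (fun x f x' f' hx hf => restrict_unique (Quotient.sound hx) (Quotient.sound hf) _ _ _ _
      (NonzeroSub.exists_restrict x.1 f.1 f.2).choose_spec.choose_spec.choose_spec
      (NonzeroSub.exists_restrict x'.1 f'.1 f'.2).choose_spec.choose_spec.choose_spec)

lemma act_mk {S T W : NonzeroSub H.obj} (x : F.obj (op (S.sub : A))) (f : (T.sub : A) ⟶ H.obj)
    (h : T ≤ W) (g : (W.sub : A) ⟶ (S.sub : A))
    (hg : g ≫ S.sub.arrow = NonzeroSub.incl h ≫ f) :
    act (mk S x) (ResidueField.mk T f) = mk W (F.map g.op x) :=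
  restrict_unique rfl rfl _ h _ g
    (NonzeroSub.exists_restrict S T f).choose_spec.choose_spec.choose_spec hg

lemma act_add_left (z z' : Value H F) (c : ResidueField H) :
    act (z + z') c = act z c + act z' c := by
  obtain ⟨S, x, y, rfl, rfl⟩ := mk_surj₂ z z'
  obtain ⟨T, f, rfl⟩ := ResidueField.mk_surj c
  obtain ⟨W, h, g, hg⟩ := NonzeroSub.exists_restrict S T f
  rw [← mk_add, act_mk _ _ h g hg, act_mk _ _ h g hg, act_mk _ _ h g hg, map_add, mk_add]

lemma act_zero_left (c : ResidueField H) : act (0 : Value H F) c = 0 := by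
  have := act_add_left (0 : Value H F) 0 c
  rwa [add_zero, left_eq_add] at this

lemma act_add_right [F.Additive] (z : Value H F) (c c' : ResidueField H) :
    act z (c + c') = act z c + act z c' := by
  obtain ⟨S, x, rfl⟩ := mk_surj z
  obtain ⟨T, f, f', rfl, rfl⟩ := ResidueField.mk_surj₂ c c'
  obtain ⟨W, h, g, hg⟩ := NonzeroSub.exists_restrict S T f
  obtain ⟨W', h', g', hg'⟩ := NonzeroSub.exists_restrict S T f'
  obtain ⟨V, d, d'⟩ := exists_ge_ge W W'
  have k₁ : (NonzeroSub.incl d ≫ g) ≫ S.sub.arrow = NonzeroSub.incl (h.trans d) ≫ f := by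
    rw [Category.assoc, hg, ← Category.assoc, NonzeroSub.incl_comp]
  have k₂ : (NonzeroSub.incl d' ≫ g') ≫ S.sub.arrow = NonzeroSub.incl (h.trans d) ≫ f' := by
    rw [Category.assoc, hg', ← Category.assoc, NonzeroSub.incl_comp]
  rw [← ResidueField.mk_add, act_mk _ _ (h.trans d) _ k₁, act_mk _ _ (h.trans d) _ k₂,
    act_mk _ _ (h.trans d) (NonzeroSub.incl d ≫ g + NonzeroSub.incl d' ≫ g')
      (by rw [Preadditive.add_comp, Preadditive.comp_add, k₁, k₂]),
    ← mk_add, op_add, F.map_add]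
  rfl

lemma act_zero_right [F.Additive] (z : Value H F) : act z 0 = 0 := by
  have := act_add_right z 0 0
  rwa [add_zero, left_eq_add] at this

end Value

namespace ResidueField

variable {H}

instance : One (ResidueField H) :=
  ⟨mk ⟨⊤, top_ne_bot_of_isMonoform H.isMonoform⟩ (⊤ : Subobject H.obj).arrow⟩

/-- The multiplication of `k(α)` is induced by the composition of morphisms. -/
instance : Mul (ResidueField H) :=
  ⟨fun c c' => Value.act (F := preadditiveYoneda.obj H.obj) c c'⟩

lemma one_def (S : NonzeroSub H.obj) : (1 : ResidueField H) = mk S S.sub.arrow := by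
  have h : (⟨⊤, top_ne_bot_of_isMonoform H.isMonoform⟩ : NonzeroSub H.obj) ≤ S :=
    le_top (α := Subobject H.obj)
  exact (mk_restrict h (⊤ : Subobject H.obj).arrow).symm.trans (by
    rw [NonzeroSub.incl_arrow h])

lemma mk_mul_mk {S T W : NonzeroSub H.obj} (f' : (S.sub : A) ⟶ H.obj) (f : (T.sub : A) ⟶ H.obj)
    (h : T ≤ W) (g : (W.sub : A) ⟶ (S.sub : A))
    (hg : g ≫ S.sub.arrow = NonzeroSub.incl h ≫ f) :
    mk S f' * mk T f = mk W (g ≫ f') :=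
  Value.act_mk (F := preadditiveYoneda.obj H.obj) f' f h g hg

end ResidueField

namespace Value

variable {H F G}

lemma act_one (z : Value H F) : act z 1 = z := by
  obtain ⟨S, x, rfl⟩ := mk_surj z
  rw [ResidueField.one_def S, act_mk x S.sub.arrow (le_refl S) (𝟙 _) (by simp)]
  simp

lemma act_mul (z : Value H F) (c c' : ResidueField H) : act z (c * c') = act (act z c) c' := by
  obtain ⟨S, x, rfl⟩ := mk_surj z
  obtain ⟨T, f, rfl⟩ := ResidueField.mk_surj c
  obtain ⟨T', f', rfl⟩ := ResidueField.mk_surj c'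
  obtain ⟨W, h, g, hg⟩ := NonzeroSub.exists_restrict S T f
  obtain ⟨W', h', g', hg'⟩ := NonzeroSub.exists_restrict W T' f'
  rw [act_mk x f h g hg, act_mk _ f' h' g' hg', ← ResidueField.mk_restrict h f,
    ResidueField.mk_mul_mk _ f' h' g' hg', act_mk x _ (le_refl W') (g' ≫ g) (by simp [hg])]
  simp

lemma map_act (τ : F ⟶ G) (z : Value H F) (c : ResidueField H) :
    map τ (act z c) = act (map τ z) c := by
  obtain ⟨S, x, rfl⟩ := mk_surj z
  obtain ⟨T, f, rfl⟩ := ResidueField.mk_surj c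
  obtain ⟨W, h, g, hg⟩ := NonzeroSub.exists_restrict S T f
  rw [act_mk x f h g hg, map_mk, map_mk, act_mk _ f h g hg]
  exact congrArg (mk W) (NatTrans.naturality_apply τ g.op x)

end Value

instance : Ring (ResidueField H) where
  __ := (inferInstance : AddCommGroup (ResidueField H))
  left_distrib a b c := Value.act_add_right (F := preadditiveYoneda.obj H.obj) a b c
  right_distrib a b c := Value.act_add_left (F := preadditiveYoneda.obj H.obj) a b c
  zero_mul a := Value.act_zero_left (F := preadditiveYoneda.obj H.obj) a
  mul_zero a := Value.act_zero_right (F := preadditiveYoneda.obj H.obj) a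
  mul_assoc a b c := (Value.act_mul (F := preadditiveYoneda.obj H.obj) a b c).symm
  one_mul a := by
    obtain ⟨T, f, rfl⟩ := ResidueField.mk_surj a
    obtain ⟨W, h, g, hg⟩ := NonzeroSub.exists_restrict T T f
    rw [ResidueField.one_def T, ResidueField.mk_mul_mk _ f h g hg, hg,
      ResidueField.mk_restrict]
  mul_one a := Value.act_one (F := preadditiveYoneda.obj H.obj) a

/-- `F(α)` is a right `k(α)`-module. -/
instance [F.Additive] : Module (ResidueField H)ᵐᵒᵖ (Value H F) where
  smul c z := Value.act z c.unop
  one_smul z := Value.act_one z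
  mul_smul c c' z := Value.act_mul z c'.unop c.unop
  smul_zero c := Value.act_zero_left c.unop
  smul_add c z z' := Value.act_add_left z z' c.unop
  add_smul c c' z := Value.act_add_right z c.unop c'.unop
  zero_smul z := Value.act_zero_right z

/-- A natural transformation induces a `k(α)`-linear map on the values at an atom. -/
def Value.mapₗ {F G : Aᵒᵖ ⥤ AddCommGrpCat.{w}} [F.Additive] [G.Additive] (τ : F ⟶ G) :
    Value H F →ₗ[(ResidueField H)ᵐᵒᵖ] Value H G where
  toFun := Value.map τ
  map_add' := map_add _
  map_smul' c z := Value.map_act τ z c.unop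

end Limit

section Ext

variable [HasExt.{w} A]

instance (i : ℕ) (N : A) : ((Abelian.extFunctor.{w} (C := A) i).flip.obj N).Additive where
  map_add {X Y f g} := by
    have h : (Abelian.extFunctor.{w} (C := A) i).map (f + g) =
        (Abelian.extFunctor.{w} i).map f + (Abelian.extFunctor.{w} i).map g := Functor.map_add _
    exact congrArg (fun τ => NatTrans.app τ N) h

/-- `Ext^i(α, N)`, the direct limit of `Ext^i(H', N)` over the nonzero subobjects `H'` of the
representative `H` of the atom `α`. -/
abbrev AtomExt (H : MonoformObj A) (i : ℕ) (N : A) : Type (max u v w) :=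
  Value H ((Abelian.extFunctor.{w} i).flip.obj N)

/-- The map `Ext^i(α, N) → Ext^i(α, N')` induced by a morphism `N ⟶ N'`. -/
def atomExtMap (H : MonoformObj A) (i : ℕ) {N N' : A} (f : N ⟶ N') :
    AtomExt.{w} H i N →ₗ[(ResidueField H)ᵐᵒᵖ] AtomExt.{w} H i N' :=
  Value.mapₗ H ((Abelian.extFunctor.{w} i).flip.map f)

/-- The dual `D_α Ext^i(α, N)` of right `k(α)`-linear maps to `k(α)`; it is a left `k(α)`-module. -/
abbrev DualAtomExt (H : MonoformObj A) (i : ℕ) (N : A) : Type (max u v w) :=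
  AtomExt.{w} H i N →ₗ[(ResidueField H)ᵐᵒᵖ] ResidueField H

/-- The transition maps `D_α Ext^i(α, S) → D_α Ext^i(α, T)` for `T ⊆ S`. -/
def dualTransition (H : MonoformObj A) (i : ℕ) (K : MonoformObj A) (S T : NonzeroSub K.obj)
    (h : S ≤ T) : DualAtomExt.{w} H i (S.sub : A) →ₗ[ResidueField H]
      DualAtomExt.{w} H i (T.sub : A) where
  toFun φ := φ.comp (atomExtMap H i (NonzeroSub.incl h))
  map_add' _ _ := rfl
  map_smul' _ _ := rfl

lemma atomExtMap_id (H : MonoformObj A) (i : ℕ) (N : A) (z : AtomExt.{w} H i N) :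
    atomExtMap H i (𝟙 N) z = z := by
  obtain ⟨S, x, rfl⟩ := Value.mk_surj z
  change Value.mk S (((Abelian.extFunctor.{w} i).flip.map (𝟙 N)).app _ x) = _
  rw [CategoryTheory.Functor.map_id]
  rfl

lemma atomExtMap_comp (H : MonoformObj A) (i : ℕ) {N N' N'' : A} (f : N ⟶ N') (g : N' ⟶ N'')
    (z : AtomExt.{w} H i N) :
    atomExtMap H i (f ≫ g) z = atomExtMap H i g (atomExtMap H i f z) := by
  obtain ⟨S, x, rfl⟩ := Value.mk_surj z
  change Value.mk S (((Abelian.extFunctor.{w} i).flip.map (f ≫ g)).app _ x) = _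
  rw [CategoryTheory.Functor.map_comp]
  rfl

instance (H : MonoformObj A) (i : ℕ) (K : MonoformObj A) :
    DirectedSystem (fun S : NonzeroSub K.obj => DualAtomExt.{w} H i (S.sub : A))
      (fun S T h => dualTransition H i K S T h) where
  map_self S φ := by
    ext z
    change φ (atomExtMap H i (NonzeroSub.incl (le_refl S)) z) = φ z
    rw [NonzeroSub.incl_refl, atomExtMap_id]
  map_map U T S h h' φ := by
    ext z
    change φ (atomExtMap H i (NonzeroSub.incl h) (atomExtMap H i (NonzeroSub.incl h') z)) =
      φ (atomExtMap H i (NonzeroSub.incl (h.trans h')) z)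
    rw [← NonzeroSub.incl_comp h h', atomExtMap_comp]

/-- The virtual dual of `Ext^i(α, β)`, where `H` and `K` are the representatives of `α` and `β`:
the direct limit of `D_α Ext^i(α, K')` over the nonzero subobjects `K'` of `K`. -/
abbrev VirtualDualExt (H : MonoformObj A) (i : ℕ) (K : MonoformObj A) : Type (max u v w) :=
  DirectLimit (fun S : NonzeroSub K.obj => DualAtomExt.{w} H i (S.sub : A)) (dualTransition H i K)

variable (A) in
/-- The global dimension of `A`. The bottom element, which is the supremum of the empty set,
stands for the value `-1`. -/
def globalDimension : WithBot ℕ∞ :=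
  sSup {d | ∃ i : ℕ, d = (i : WithBot ℕ∞) ∧ ∃ M N : A, Nontrivial (Abelian.Ext.{w} M N i)}

end Ext

variable (A) in
/-- `A` is a locally noetherian Grothendieck category: a Grothendieck category with a small
generating set of noetherian objects. -/
def IsLocallyNoetherianGrothendieck : Prop :=
  IsGrothendieckAbelian.{v} A ∧
    ∃ (ι : Type v) (U : ι → A), (∀ j, IsNoetherianObject (U j)) ∧
      ∀ ⦃X Y : A⦄ (f : X ⟶ Y), f ≠ 0 → ∃ (j : ι) (g : U j ⟶ X), g ≫ f ≠ 0

variable (A) in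
/-- `A` is a noetherian abelian category: it is skeletally small and all its objects are
noetherian. -/
def IsNoetherianAbelian : Prop :=
  (∀ X : A, IsNoetherianObject X) ∧ EssentiallySmall.{v} A

variable (A) in
/-- A choice of a fixed monoform representative of each atom. -/
structure Representatives where
  rep : ASpec A → MonoformObj A
  atom_rep : ∀ α, (rep α).atom = α

end AtomSpectrum

end

noncomputable section

namespace AtomSpectrum

/-! ### Factorization through subobjects. -/

section Subobject

/-! Both existence statements rest on one maximality argument for a half exact functor. For the
second variable, `k(α)` is a skew field, so a nonzero `Ext^i(α, N)` carries a nonzero functional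
`φ`, and `D_α Ext^i(α, -)` is again half exact. Take `L ⊆ N` maximal among the subobjects on which
`φ` restricts to zero. Then `φ` is induced by a functional `ψ` of `N / L ≠ 0`, and `N / L` contains
a monoform `K`, whose atom lies in `ASupp N`. If the virtual dual at that atom vanished, `ψ` would
vanish on some nonzero `K' ⊆ K`, hence `φ` on the preimage of `K'`, which is strictly larger than
`L`: a contradiction (`exists_virtualDualExt_of_maximal`).

If `N` is noetherian, `L` exists at once. In the Grothendieck case it comes from Zorn's lemma:
classes with noetherian source and coefficients in the union of a chain come from a member of the
chain, up to pushing forward to the ambient object (`exists_ext_of_isChain`), and every class in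
`Ext^i(α, -)` is represented on a noetherian subobject.

The same argument for `Ext^i(-, N)` produces `α ∈ ASupp M` with `Ext^i(α, N) ≠ 0` when `M` is
noetherian (`ext_eq_zero_of_isNoetherianObject`). For general `M` in a Grothendieck category a class
vanishing along a chain need not vanish on its union, so Zorn's lemma cannot be applied to the class
itself. A Baer-type criterion (`ext_one_eq_zero_of_subquotients`), which applies Zorn's lemma to
partial splittings instead, and dimension shifting reduce to noetherian subquotients of `M`.
Chaining the two variables gives the second claim. The third follows because a nonzero virtual dual
forces some `Ext^i` to be nonzero. -/

lemma le_iff_factors_arrow {C : Type u} [Category.{v} C] {X : C} (S T : Subobject X) :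
    S ≤ T ↔ T.Factors S.arrow := by
  refine ⟨fun h => Subobject.factors_of_le _ h (Subobject.factors_self S), fun h => ?_⟩
  exact Subobject.le_of_comm (T.factorThru _ h) (T.factorThru_arrow _ h)

lemma exists_factors_iff {C : Type u} [Category.{v} C] {X Y : C} (T : Subobject Y)
    (f : X ⟶ Y) : T.Factors f ↔ ∃ g : X ⟶ (T : C), g ≫ T.arrow = f :=
  ⟨fun h => ⟨_, T.factorThru_arrow f h⟩, fun ⟨_, h⟩ => h ▸ Subobject.factors_comp_arrow _⟩

end Subobject

variable {A : Type u} [Category.{v} A] [Abelian A]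

section Subobject

lemma factors_iff_comp_cokernel_π {X Y : A} (T : Subobject Y) (f : X ⟶ Y) :
    T.Factors f ↔ f ≫ cokernel.π T.arrow = 0 := by
  constructor
  · intro h
    rw [← T.factorThru_arrow f h, Category.assoc, cokernel.condition, comp_zero]
  · intro h
    exact (Subobject.factors_iff _ _).2 ⟨Abelian.monoLift T.arrow f h, by
      exact Abelian.monoLift_comp T.arrow f h⟩

/-- Factoring through `T` means dying in the cokernel, which can be tested after an epimorphism.
This lets inclusions of subobjects be checked on elements up to refinement. -/
lemma factors_of_epi_comp {X Y Z : A} (T : Subobject Z) (p : X ⟶ Y) [Epi p] (f : Y ⟶ Z)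
    (h : T.Factors (p ≫ f)) : T.Factors f := by
  rw [factors_iff_comp_cokernel_π] at h ⊢
  rwa [Category.assoc, ← cancel_epi p, comp_zero] at *

lemma isZero_coe_iff {X : A} (S : Subobject X) : IsZero (S : A) ↔ S = ⊥ := by
  rw [subobject_eq_bot_iff]
  refine ⟨fun h => h.eq_of_src _ _, fun h => (IsZero.iff_id_eq_zero _).2 ?_⟩
  exact (cancel_mono S.arrow).1 (by rw [h, comp_zero, comp_zero])

lemma mk_ne_bot {X Y : A} (m : X ⟶ Y) [Mono m] (hX : ¬ IsZero X) : Subobject.mk m ≠ ⊥ := by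
  intro h
  exact hX ((isZero_coe_iff _).2 h |>.of_iso (Subobject.underlyingIso m).symm)

end Subobject

/-! ### Noetherian objects: closure properties and abundance. -/

section Noetherian

/-- A subobject of `Y` is determined by its preimage under the epimorphism `p`. -/
lemma isNoetherianObject_of_epi {X Y : A} (p : X ⟶ Y) [Epi p] [IsNoetherianObject X] :
    IsNoetherianObject Y := by
  rw [isNoetherianObject_iff_monotone_chain_condition]
  intro f
  obtain ⟨n, hn⟩ := monotone_chain_condition_of_isNoetherianObject
    ⟨_, (Subobject.pullback p).monotone.comp f.2⟩
  refine ⟨n, fun m hm => le_antisymm (f.2 hm) ?_⟩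
  rw [le_iff_factors_arrow]
  obtain ⟨W, π, _, x, hx⟩ := surjective_up_to_refinements_of_epi p (f m).arrow
  refine factors_of_epi_comp _ π _ ?_
  rw [hx]
  have h : ((Subobject.pullback p).obj (f m)).Factors x :=
    (Limits.pullback_factors_iff _ _ _).2 (hx ▸ Subobject.factors_comp_arrow π)
  have hn' : (Subobject.pullback p).obj (f n) = (Subobject.pullback p).obj (f m) := hn m hm
  rw [← hn'] at h
  exact (Limits.pullback_factors_iff _ _ _).1 h

/-- Once the traces on `X₁` and the images in `X₃` are stationary, so is the chain: up to
refinement, an element of `f m` agrees modulo `X₁` with an element of `f n`, and the difference lies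
in the common trace. -/
lemma isNoetherianObject_of_shortExact {S : ShortComplex A} (hS : S.ShortExact)
    [IsNoetherianObject S.X₁] [IsNoetherianObject S.X₃] : IsNoetherianObject S.X₂ := by
  rw [isNoetherianObject_iff_monotone_chain_condition]
  intro f
  have := hS.mono_f
  obtain ⟨n₁, hn₁⟩ := monotone_chain_condition_of_isNoetherianObject
    ⟨_, (Subobject.pullback S.f).monotone.comp f.2⟩
  obtain ⟨n₃, hn₃⟩ := monotone_chain_condition_of_isNoetherianObject
    ⟨fun n => imageSubobject ((f n).arrow ≫ S.g), fun a b hab => by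
      have h : f a ≤ f b := f.2 hab
      dsimp only
      rw [← Subobject.ofLE_arrow h, Category.assoc]
      exact imageSubobject_comp_le _ _⟩
  refine ⟨max n₁ n₃, fun m hm => le_antisymm (f.2 hm) ?_⟩
  set n := max n₁ n₃
  have h₁ : (Subobject.pullback S.f).obj (f n) = (Subobject.pullback S.f).obj (f m) :=
    (hn₁ n (le_max_left _ _)).symm.trans (hn₁ m ((le_max_left _ _).trans hm))
  have h₃ : imageSubobject ((f n).arrow ≫ S.g) = imageSubobject ((f m).arrow ≫ S.g) :=
    (hn₃ n (le_max_right _ _)).symm.trans (hn₃ m ((le_max_right _ _).trans hm))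
  have hfac : (imageSubobject ((f n).arrow ≫ S.g)).Factors ((f m).arrow ≫ S.g) := by
    rw [h₃]
    exact (exists_factors_iff _ _).2 ⟨_, imageSubobject_arrow_comp _⟩
  obtain ⟨W, π, _, b, hb⟩ := surjective_up_to_refinements_of_epi
    (factorThruImageSubobject ((f n).arrow ≫ S.g)) (Subobject.factorThru _ _ hfac)
  have hb' : π ≫ (f m).arrow ≫ S.g = b ≫ (f n).arrow ≫ S.g := by
    have := congrArg (· ≫ (imageSubobject ((f n).arrow ≫ S.g)).arrow) hb
    simpa using this
  have hd : (π ≫ (f m).arrow - b ≫ (f n).arrow) ≫ S.g = 0 := by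
    rw [Preadditive.sub_comp, Category.assoc, Category.assoc, hb', sub_self]
  rw [le_iff_factors_arrow]
  refine factors_of_epi_comp _ π _ ?_
  have hm' : (f m).Factors (π ≫ (f m).arrow - b ≫ (f n).arrow) := by
    refine (exists_factors_iff _ _).2 ⟨π - b ≫ Subobject.ofLE _ _ (f.2 hm), ?_⟩
    simp
  have hn' : (f n).Factors (π ≫ (f m).arrow - b ≫ (f n).arrow) := by
    have e := hS.exact.lift_f _ hd
    rw [← e] at hm' ⊢
    rw [← Limits.pullback_factors_iff] at hm' ⊢
    rwa [h₁]
  obtain ⟨c, hc⟩ := (exists_factors_iff _ _).1 hn'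
  exact (exists_factors_iff _ _).2 ⟨c + b, by rw [Preadditive.add_comp, hc]; abel⟩

instance isNoetherianObject_biprod (X Y : A) [IsNoetherianObject X] [IsNoetherianObject Y] :
    IsNoetherianObject (X ⊞ Y) := by
  let S := ShortComplex.mk (biprod.inl : X ⟶ X ⊞ Y) (biprod.snd : X ⊞ Y ⟶ Y) (by simp)
  have hS : S.ShortExact :=
    (ShortComplex.Splitting.mk (S := S) biprod.fst biprod.inr (by simp [S]) (by simp [S])
      (by simp [S])).shortExact
  have : IsNoetherianObject S.X₁ := ‹IsNoetherianObject X›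
  have : IsNoetherianObject S.X₃ := ‹IsNoetherianObject Y›
  exact isNoetherianObject_of_shortExact hS

variable (A) in
/-- `A` has enough noetherian objects: nonzero morphisms are detected on noetherian objects. -/
def HasEnoughNoetherian : Prop :=
  ∀ ⦃X Y : A⦄ (f : X ⟶ Y), f ≠ 0 → ∃ (U : A) (_ : IsNoetherianObject U) (g : U ⟶ X), g ≫ f ≠ 0

lemma IsLocallyNoetherianGrothendieck.hasEnoughNoetherian
    (hA : IsLocallyNoetherianGrothendieck A) : HasEnoughNoetherian A := by
  obtain ⟨-, ι, U, hU, h⟩ := hA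
  intro X Y f hf
  obtain ⟨j, g, hg⟩ := h f hf
  exact ⟨U j, hU j, g, hg⟩

lemma IsNoetherianAbelian.hasEnoughNoetherian (hA : IsNoetherianAbelian A) :
    HasEnoughNoetherian A :=
  fun X _ f hf => ⟨X, hA.1 X, 𝟙 X, by rwa [Category.id_comp]⟩

lemma HasEnoughNoetherian.exists_subobject (hA : HasEnoughNoetherian A) {X Y : A} (f : X ⟶ Y)
    (hf : f ≠ 0) : ∃ S : Subobject X, IsNoetherianObject (S : A) ∧ S.arrow ≫ f ≠ 0 := by
  obtain ⟨U, _, g, hg⟩ := hA f hf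
  refine ⟨imageSubobject g, isNoetherianObject_of_epi (factorThruImageSubobject g), fun h => hg ?_⟩
  rw [← imageSubobject_arrow_comp g, Category.assoc, h, comp_zero]

lemma HasEnoughNoetherian.exists_noetherian_ne_bot (hA : HasEnoughNoetherian A) {X : A}
    (hX : ¬ IsZero X) : ∃ S : Subobject X, IsNoetherianObject (S : A) ∧ S ≠ ⊥ := by
  obtain ⟨S, h, hS⟩ := hA.exists_subobject (𝟙 X) (fun h => hX ((IsZero.iff_id_eq_zero X).2 h))
  refine ⟨S, h, fun h0 => hS ?_⟩
  rw [Category.comp_id, (subobject_eq_bot_iff S).1 h0]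

/-- An epimorphism onto a noetherian object is an epimorphism on some noetherian subobject. -/
lemma HasEnoughNoetherian.exists_epi_restrict (hA : HasEnoughNoetherian A) {X Y : A}
    [IsNoetherianObject Y] (p : X ⟶ Y) [Epi p] :
    ∃ S : Subobject X, IsNoetherianObject (S : A) ∧ Epi (S.arrow ≫ p) := by
  -- Choose a noetherian `S` with maximal image in `Y`. If the image were not all of `Y`, a
  -- noetherian `S'` not mapping into it could be added to `S`.
  let Φ : Set (Subobject Y) :=
    {T | ∃ S : Subobject X, IsNoetherianObject (S : A) ∧ T = imageSubobject (S.arrow ≫ p)}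
  have hΦ : Φ.Nonempty := by
    refine ⟨_, ⊥, ?_, rfl⟩
    exact isNoetherianObject_of_isZero ((isZero_coe_iff _).2 rfl)
  obtain ⟨T, ⟨S, hS, rfl⟩, hmax⟩ := WellFounded.has_min
    (wellFounded_gt (α := Subobject Y)) Φ hΦ
  refine ⟨S, hS, ?_⟩
  set q := cokernel.π (S.arrow ≫ p) with hq
  by_contra hepi
  have hq0 : q ≠ 0 := fun h => hepi (Preadditive.epi_of_cokernel_zero h)
  have hpq : p ≫ q ≠ 0 := fun h => hq0 ((cancel_epi p).1 (by rw [h, comp_zero]))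
  obtain ⟨S', hS', hne⟩ := hA.exists_subobject (p ≫ q) hpq
  let d : (S : A) ⊞ (S' : A) ⟶ X := biprod.desc S.arrow S'.arrow
  let R := imageSubobject d
  have hR : IsNoetherianObject (R : A) := isNoetherianObject_of_epi (factorThruImageSubobject d)
  have hR₁ : S ≤ R := (le_iff_factors_arrow _ _).2 ((exists_factors_iff _ _).2
    ⟨biprod.inl ≫ factorThruImageSubobject d, by simp [R, d]⟩)
  have hR₂ : S' ≤ R := (le_iff_factors_arrow _ _).2 ((exists_factors_iff _ _).2
    ⟨biprod.inr ≫ factorThruImageSubobject d, by simp [R, d]⟩)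
  have hle : ∀ {P Q : Subobject X}, P ≤ Q →
      imageSubobject (P.arrow ≫ p) ≤ imageSubobject (Q.arrow ≫ p) := by
    intro P Q h
    rw [← Subobject.ofLE_arrow h, Category.assoc]
    exact imageSubobject_comp_le _ _
  refine hmax (imageSubobject (R.arrow ≫ p)) ⟨R, hR, rfl⟩ (lt_of_le_of_ne (hle hR₁) ?_)
  intro h
  have h' := (hle hR₂).trans h.ge
  apply hne
  have hfac := Subobject.factors_of_le _ h'
    ((exists_factors_iff _ _).2 ⟨_, imageSubobject_arrow_comp (S'.arrow ≫ p)⟩)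
  obtain ⟨g, hg⟩ := (exists_factors_iff _ _).1 hfac
  have hz : (imageSubobject (S.arrow ≫ p)).arrow ≫ q = 0 := by
    apply (cancel_epi (factorThruImageSubobject (S.arrow ≫ p))).1
    rw [← Category.assoc, imageSubobject_arrow_comp, cokernel.condition, comp_zero]
  rw [← Category.assoc, ← hg, Category.assoc, hz, comp_zero]

end Noetherian

/-! ### Existence of monoform subobjects. -/

section Monoform

/-- This is the inclusion `Y / X → Z / X`. -/
lemma mono_cokernel_desc_of_mono {X Y Z : A} (i : X ⟶ Y) (j : Y ⟶ Z) [Mono i] [Mono j] :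
    Mono (cokernel.desc i (j ≫ cokernel.π (i ≫ j))
      (by rw [← Category.assoc, cokernel.condition])) := by
  refine Preadditive.mono_of_cancel_zero _ fun {W} x hx => ?_
  obtain ⟨W', π, _, y, hy⟩ := surjective_up_to_refinements_of_epi (cokernel.π i) x
  have h : (y ≫ j) ≫ cokernel.π (i ≫ j) = 0 := by
    have := congrArg (π ≫ ·) hx
    simp only [← Category.assoc, hy] at this
    simpa using this
  have h' : y = Abelian.monoLift (i ≫ j) (y ≫ j) h ≫ i := by
    rw [← cancel_mono j, Category.assoc, Abelian.monoLift_comp]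
  rw [← cancel_epi π, hy, h', Category.assoc, cokernel.condition, comp_zero, comp_zero]

/-- Every nonzero noetherian object has a monoform subobject. -/
lemma exists_monoform_of_isNoetherianObject {X : A} [IsNoetherianObject X] (hX : ¬ IsZero X) :
    ∃ (H : MonoformObj A) (m : H.obj ⟶ X), Mono m := by
  -- Kernels of quotients `Q` of `X` that share a nonzero subobject `Z` with `X`. For a maximal
  -- kernel, `Z` is monoform: an isomorphism `T / T' ≅ N` inside `Z` would make `Q / T'` share `N`
  -- with `X`, and its kernel is larger because `T' ≠ 0`.
  let Φ : Set (Subobject X) := {L | ∃ (Q : A) (q : X ⟶ Q) (_ : Epi q) (Z : A) (a : Z ⟶ X)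
    (b : Z ⟶ Q), L = kernelSubobject q ∧ Mono a ∧ Mono b ∧ ¬ IsZero Z}
  have hΦ : Φ.Nonempty :=
    ⟨_, X, 𝟙 X, inferInstance, X, 𝟙 X, 𝟙 X, rfl, inferInstance, inferInstance, hX⟩
  obtain ⟨L, ⟨Q, q, _, Z, a, b, rfl, _, _, hZ⟩, hmax⟩ := WellFounded.has_min
    (wellFounded_gt (α := Subobject X)) Φ hΦ
  refine ⟨⟨Z, hZ, fun T' T hT hT' N hN => ⟨fun e => ?_⟩⟩, a, inferInstance⟩
  let i := Subobject.ofLE T' T hT.le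
  let j := T.arrow ≫ b
  let q' := q ≫ cokernel.π (i ≫ j)
  refine hmax (kernelSubobject q') ⟨_, q', inferInstance, N, N.arrow ≫ a,
    e.inv ≫ cokernel.desc i (j ≫ cokernel.π (i ≫ j))
      ((Category.assoc _ _ _).symm.trans (cokernel.condition _)), rfl, inferInstance, ?_,
      fun h => hN ((isZero_coe_iff N).1 h)⟩ ?_
  · have := mono_cokernel_desc_of_mono i j
    exact mono_comp _ _
  · refine lt_of_le_of_ne ?_ fun h => hT' ?_
    · exact le_kernelSubobject _ _ (by simp [q'])
    -- Elements of `T'`, lifted to `X`, lie in the kernel of `q'`. Equal kernels would put them in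
    -- the kernel of `q`, forcing `T' = 0`.
    · obtain ⟨W, π, _, x, hx⟩ := surjective_up_to_refinements_of_epi q (i ≫ j)
      have h₁ : (kernelSubobject q').Factors x := by
        rw [kernelSubobject_factors_iff]
        calc x ≫ q ≫ cokernel.π (i ≫ j) = π ≫ (i ≫ j) ≫ cokernel.π (i ≫ j) := by
              rw [← Category.assoc x q, ← hx, Category.assoc π]
          _ = 0 := by rw [cokernel.condition, comp_zero]
      rw [← h, kernelSubobject_factors_iff, ← hx] at h₁
      have h₂ : i ≫ j = 0 := (cancel_epi π).1 (by rw [h₁, comp_zero])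
      rw [subobject_eq_bot_iff]
      apply (cancel_mono b).1
      rw [zero_comp, ← h₂, ← Category.assoc, Subobject.ofLE_arrow]

lemma HasEnoughNoetherian.exists_monoform (hA : HasEnoughNoetherian A) {X : A}
    (hX : ¬ IsZero X) : ∃ (H : MonoformObj A) (m : H.obj ⟶ X), Mono m := by
  obtain ⟨S, _, hS⟩ := hA.exists_noetherian_ne_bot hX
  obtain ⟨H, m, _⟩ := exists_monoform_of_isNoetherianObject
    (fun h => hS ((isZero_coe_iff S).1 h))
  exact ⟨H, m ≫ S.arrow, mono_comp _ _⟩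

end Monoform

/-! ### Subquotients and atom supports. -/

section Subquotient

/-- With the next lemma but in the other direction, this turns subquotients into subobjects of
quotients, a form that composes easily. Here `X` is its preimage in `M` modulo the kernel of `q`. -/
lemma isSubquotient_of_mono_of_epi {X M Q : A} (q : M ⟶ Q) [Epi q] (m : X ⟶ Q) [Mono m] :
    IsSubquotient X M := by
  let L := (Subobject.pullback q).obj (Subobject.mk m)
  have hL : (Subobject.mk m).Factors (L.arrow ≫ q) :=
    (Limits.pullback_factors_iff _ _ _).1 (Subobject.factors_self L)
  have hle : kernelSubobject q ≤ L := by
    rw [le_iff_factors_arrow]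
    exact (Limits.pullback_factors_iff _ _ _).2
      (by rw [kernelSubobject_arrow_comp]; exact Subobject.factors_zero)
  refine ⟨kernelSubobject q, L, hle, ?_⟩
  let t : (L : A) ⟶ X := (Subobject.mk m).factorThru _ hL ≫ (Subobject.underlyingIso m).hom
  have ht : t ≫ m = L.arrow ≫ q := by simp [t]
  have hzero : Subobject.ofLE _ _ hle ≫ t = 0 := by
    rw [← cancel_mono m, Category.assoc, ht, ← Category.assoc, Subobject.ofLE_arrow,
      kernelSubobject_arrow_comp, zero_comp]
  have hepi : Epi t := by
    rw [epi_iff_surjective_up_to_refinements]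
    intro W y
    obtain ⟨W', π, hπ, x, hx⟩ := surjective_up_to_refinements_of_epi q (y ≫ m)
    have hx' : L.Factors x := (Limits.pullback_factors_iff _ _ _).2
      (by rw [← hx, ← Category.assoc]; exact (Subobject.mk_factors_iff _ _).2 ⟨_, rfl⟩)
    refine ⟨W', π, hπ, L.factorThru x hx', ?_⟩
    rw [← cancel_mono m, Category.assoc, Category.assoc, ht, ← Category.assoc _ L.arrow,
      Subobject.factorThru_arrow, hx]
  have hex : (ShortComplex.mk _ _ hzero).Exact := by
    rw [ShortComplex.exact_iff_exact_up_to_refinements]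
    intro W x hx
    dsimp at x hx ⊢
    have h : (kernelSubobject q).Factors (x ≫ L.arrow) := by
      rw [kernelSubobject_factors_iff, Category.assoc, ← ht, ← Category.assoc, hx, zero_comp]
    refine ⟨W, 𝟙 W, inferInstance, (kernelSubobject q).factorThru _ h, ?_⟩
    rw [← cancel_mono L.arrow, Category.assoc, Category.id_comp]
    simp
  exact ⟨IsColimit.coconePointUniqueUpToIso (colimit.isColimit _) hex.gIsCokernel⟩

lemma IsSubquotient.exists_mono_epi {X M : A} (h : IsSubquotient X M) :
    ∃ (Q : A) (q : M ⟶ Q) (m : X ⟶ Q), Epi q ∧ Mono m := by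
  obtain ⟨L', L, hL, ⟨e⟩⟩ := h
  have := mono_cokernel_desc_of_mono (Subobject.ofLE L' L hL) L.arrow
  exact ⟨_, cokernel.π (Subobject.ofLE L' L hL ≫ L.arrow), e.inv ≫ _, inferInstance,
    mono_comp e.inv (cokernel.desc (Subobject.ofLE L' L hL)
      (L.arrow ≫ cokernel.π (Subobject.ofLE L' L hL ≫ L.arrow))
      ((Category.assoc _ _ _).symm.trans (cokernel.condition _)))⟩

/-- A subobject of a quotient `Q` of `X` embeds in the pushout of `Q` along `m`, which is a quotient
of `Y`. -/
lemma aSupp_subset_of_mono {X Y : A} (m : X ⟶ Y) [Mono m] : aSupp X ⊆ aSupp Y := by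
  rintro _ ⟨H, hH, rfl⟩
  obtain ⟨Q, q, i, _, _⟩ := hH.exists_mono_epi
  refine ⟨H, ?_, rfl⟩
  exact isSubquotient_of_mono_of_epi (pushout.inl m q) (i ≫ pushout.inr m q)

lemma aSupp_subset_of_epi {X Y : A} (p : X ⟶ Y) [Epi p] : aSupp Y ⊆ aSupp X := by
  rintro _ ⟨H, hH, rfl⟩
  obtain ⟨Q, q, i, _, _⟩ := hH.exists_mono_epi
  exact ⟨H, isSubquotient_of_mono_of_epi (p ≫ q) i, rfl⟩

lemma MonoformObj.atom_mem_aSupp {H : MonoformObj A} {X : A} (m : H.obj ⟶ X) [Mono m] :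
    H.atom ∈ aSupp X :=
  ⟨H, isSubquotient_of_mono_of_epi (𝟙 X) m, rfl⟩

end Subquotient

/-! ### Noetherian objects and directed unions in a Grothendieck category. -/

section DirectedUnion

variable [IsGrothendieckAbelian.{v} A]

/-- A family of subobjects, as a functor. -/
def subobjectFunctor {J : Type v} [Preorder J] {Y : A} (P : J →o Subobject Y) : J ⥤ A :=
  P.monotone.functor ⋙ Subobject.underlying

/-- The inclusions of a family of subobjects, as a natural transformation. -/
def subobjectFunctorArrow {J : Type v} [Preorder J] {Y : A} (P : J →o Subobject Y) :
    subobjectFunctor P ⟶ (Functor.const J).obj Y where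
  app j := (P j).arrow
  naturality j k f := by
    dsimp [subobjectFunctor]
    rw [Category.comp_id]
    exact Subobject.underlying_arrow _

/-- A morphism from a noetherian object to the sum of a directed family of subobjects factors
through a member of the family. -/
lemma exists_factors_of_directed {J : Type v} [Preorder J] [IsDirectedOrder J] [Nonempty J]
    {X Y : A} [IsNoetherianObject X] (P : J →o Subobject Y) (f : X ⟶ Y)
    (hf : (⨆ j, P j).Factors f) : ∃ j, (P j).Factors f := by
  have : IsConnected J := IsFiltered.isConnected J
  let τ := subobjectFunctorArrow P
  let π := cokernel.π τ
  -- At `j` this is `X → Y → Y / P j`, so its kernel is the preimage of `P j` under `f`.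
  let g : (Functor.const J).obj X ⟶ cokernel τ := (Functor.const J).map f ≫ π
  obtain ⟨j₀⟩ := (inferInstance : Nonempty J)
  let q : Y ⟶ colimit (cokernel τ) := π.app j₀ ≫ colimit.ι _ j₀
  have hπ : ∀ {j k : J} (h : j ≤ k), π.app k = π.app j ≫ (cokernel τ).map (homOfLE h) := by
    intro j k h
    have := π.naturality (homOfLE h)
    simpa using this
  have hq : ∀ j, π.app j ≫ colimit.ι _ j = q := by
    have : ∀ {j k : J} (h : j ≤ k),
        π.app k ≫ colimit.ι (cokernel τ) k = π.app j ≫ colimit.ι (cokernel τ) j := by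
      intro j k h
      rw [hπ h, Category.assoc, colimit.w]
    intro j
    obtain ⟨k, h, h'⟩ := exists_ge_ge j j₀
    rw [← this h, this h']
  have hPπ : ∀ j, (P j).arrow ≫ π.app j = 0 := fun j =>
    congrArg (fun t => NatTrans.app t j) (cokernel.condition τ)
  have hfq : f ≫ q = 0 := by
    have hle : (⨆ j, P j) ≤ kernelSubobject q := iSup_le fun j => by
      rw [le_iff_factors_arrow, kernelSubobject_factors_iff, ← hq j, ← Category.assoc, hPπ,
        zero_comp]
    exact (kernelSubobject_factors_iff q f).1 (Subobject.factors_of_le f hle hf)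
  let κ := kernel g
  let t : colimit κ ⟶ X := colimit.desc κ ⟨X, kernel.ι g⟩
  have ht : ∀ j, colimit.ι κ j ≫ t = (kernel.ι g).app j := fun j => colimit.ι_desc _ _
  -- Exactness of filtered colimits makes `colim (ker g) → X → colim (Y / P j)` exact. The second
  -- map is induced by `f ≫ q = 0`, so the preimages of the `P j` together cover `X`.
  have hepi : Epi t :=
    (colim.exact_mapShortComplex
      ((ShortComplex.mk _ _ (kernel.condition g)).exact_of_f_is_kernel (kernelIsKernel g))
      (colimit.isColimit _) (isColimitConstCocone _ _) (colimit.isColimit _) t 0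
      (fun j => (ht j).trans (Category.comp_id _).symm)
      (fun j => by
        dsimp [g]
        rw [Category.assoc, hq, hfq]
        exact comp_zero)).epi_f rfl
  let R : J → Subobject X := fun j => Subobject.mk ((kernel.ι g).app j)
  have hR : Monotone R := fun j k h => Subobject.mk_le_mk_of_comm (κ.map (homOfLE h)) (by
    simp)
  -- As `X` is noetherian, the directed family of preimages has a largest member, which is then all
  -- of `X`.
  obtain ⟨_, ⟨j, rfl⟩, hmax⟩ := WellFounded.has_min
    (wellFounded_gt (α := Subobject X)) (Set.range R) ⟨R j₀, j₀, rfl⟩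
  have hle : ∀ k, R k ≤ R j := by
    intro k
    obtain ⟨l, h, h'⟩ := exists_ge_ge j k
    have : R j = R l := by
      by_contra hne
      exact hmax (R l) ⟨l, rfl⟩ (lt_of_le_of_ne (hR h) hne)
    exact this ▸ hR h'
  have htc : t ≫ cokernel.π ((kernel.ι g).app j) = 0 := by
    apply colimit.hom_ext
    intro k
    rw [← Category.assoc, ht, comp_zero, ← Subobject.ofMkLEMk_comp (hle k), Category.assoc,
      cokernel.condition, comp_zero]
  have hc : cokernel.π ((kernel.ι g).app j) = 0 := (cancel_epi t).1 (by rw [htc, comp_zero])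
  have : Epi ((kernel.ι g).app j) := Preadditive.epi_of_cokernel_zero hc
  have hfπ : f ≫ π.app j = 0 := by
    rw [← cancel_epi ((kernel.ι g).app j), comp_zero]
    exact congrArg (fun t => NatTrans.app t j) (kernel.condition g)
  refine ⟨j, ?_⟩
  have hex := ((ShortComplex.mk _ _ (cokernel.condition τ)).exact_of_g_is_cokernel
    (cokernelIsCokernel τ)).map ((evaluation J A).obj j)
  rw [ShortComplex.exact_iff_exact_up_to_refinements] at hex
  obtain ⟨W, p, _, y, hy⟩ := hex f hfπ
  exact factors_of_epi_comp _ p _ ((exists_factors_iff _ _).2 ⟨y, hy.symm⟩)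

/-- A morphism from a noetherian object to the sum of a nonempty chain of subobjects factors
through a member of the chain. -/
lemma exists_factors_of_isChain {X Y : A} [IsNoetherianObject X] {c : Set (Subobject Y)}
    (hc : IsChain (· ≤ ·) c) (hne : c.Nonempty) (f : X ⟶ Y) (hf : (sSup c).Factors f) :
    ∃ P ∈ c, P.Factors f := by
  -- The subobjects of `Y` form a `v`-small type, so the chain can be reindexed in the universe
  -- where colimits are available.
  let e := equivShrink.{v} c
  let : Preorder (Shrink.{v} c) := Preorder.lift (fun j => (e.symm j : Subobject Y))
  have : IsDirectedOrder (Shrink.{v} c) := ⟨fun a b => by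
    rcases hc.total (e.symm a).2 (e.symm b).2 with h | h
    · exact ⟨b, h, le_refl b⟩
    · exact ⟨a, le_refl a, h⟩⟩
  have : Nonempty (Shrink.{v} c) := ⟨e ⟨_, hne.choose_spec⟩⟩
  obtain ⟨j, hj⟩ := exists_factors_of_directed (J := Shrink.{v} c)
    ⟨fun j => (e.symm j : Subobject Y), fun _ _ h => h⟩ f (by
      convert hf using 1
      rw [sSup_eq_iSup']
      exact e.symm.iSup_congr (fun _ => rfl))
  exact ⟨_, (e.symm j).2, hj⟩

end DirectedUnion

/-! ### Extension classes and unions of chains. -/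

section Ext

open Abelian

variable [HasExt.{w} A]

/-- With enough injectives, a positive degree extension class is killed by an epimorphism. -/
lemma exists_epi_comp_eq_zero [EnoughInjectives A] (n : ℕ) {X Y : A}
    (x : Ext.{w} X Y (n + 1)) :
    ∃ (X' : A) (p : X' ⟶ X), Epi p ∧ (Ext.mk₀ p).comp x (zero_add _) = 0 := by
  induction n generalizing Y with
  | zero =>
    have hS : (ShortComplex.mk (Injective.ι Y) (cokernel.π (Injective.ι Y))
      (cokernel.condition _)).ShortExact :=
      ⟨ShortComplex.exact_cokernel _⟩
    obtain ⟨y, hy⟩ := Ext.covariant_sequence_exact₁ X hS x (Ext.eq_zero_of_injective _) (zero_add 1)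
    obtain ⟨f, rfl⟩ := (Ext.mk₀_bijective _ _).2 y
    -- The class is `f` followed by the class of `Y → I → I / Y`. Pulled back along `I → I / Y`, the
    -- map `f` lifts to `I` and the class dies.
    refine ⟨_, pullback.fst f (cokernel.π (Injective.ι Y)), inferInstance, ?_⟩
    rw [← hy, Ext.mk₀_comp_mk₀_assoc, pullback.condition, ← Ext.mk₀_comp_mk₀_assoc,
      hS.comp_extClass, Ext.comp_zero]
  | succ n ih =>
    have hS : (ShortComplex.mk (Injective.ι Y) (cokernel.π (Injective.ι Y))
      (cokernel.condition _)).ShortExact :=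
      ⟨ShortComplex.exact_cokernel _⟩
    obtain ⟨y, hy⟩ := Ext.covariant_sequence_exact₁ X hS x (Ext.eq_zero_of_injective _) rfl
    obtain ⟨X', p, hp, h⟩ := ih y
    refine ⟨X', p, hp, ?_⟩
    rw [← hy, ← Ext.comp_assoc _ _ _ (zero_add _) rfl (by lia), h, Ext.zero_comp]

/-- An extension class of a noetherian object by the sum of a chain of subobjects comes from a
member of the chain. -/
lemma exists_ext_of_isChain [IsGrothendieckAbelian.{v} A] (hA : HasEnoughNoetherian A)
    {Y : A} {c : Set (Subobject Y)} (hc : IsChain (· ≤ ·) c) (hne : c.Nonempty) (n : ℕ) {X : A}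
    [IsNoetherianObject X] (x : Ext.{w} X ((sSup c : Subobject Y) : A) n) :
    ∃ P ∈ c, ∃ y : Ext.{w} X (P : A) n,
      y.comp (Ext.mk₀ P.arrow) (add_zero n) = x.comp (Ext.mk₀ (sSup c).arrow) (add_zero n) := by
  induction n generalizing X with
  | zero =>
    obtain ⟨f, rfl⟩ := (Ext.mk₀_bijective _ _).2 x
    obtain ⟨P, hP, h⟩ := exists_factors_of_isChain hc hne (f ≫ (sSup c).arrow)
      (Subobject.factors_comp_arrow f)
    exact ⟨P, hP, Ext.mk₀ (P.factorThru _ h), by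
      rw [Ext.mk₀_comp_mk₀, Ext.mk₀_comp_mk₀, Subobject.factorThru_arrow]⟩
  | succ n ih =>
    -- A noetherian object covering `X` and killing `x` makes `x` the connecting image of a class of
    -- degree `n` on the kernel, which is again noetherian.
    obtain ⟨X', p, _, hp⟩ := exists_epi_comp_eq_zero n x
    obtain ⟨S, hS, _⟩ := hA.exists_epi_restrict p
    have hex : (ShortComplex.mk (kernel.ι (S.arrow ≫ p)) (S.arrow ≫ p)
      (kernel.condition _)).ShortExact := ⟨ShortComplex.exact_kernel _⟩
    obtain ⟨z, hz⟩ := Ext.contravariant_sequence_exact₃ hex _ x (by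
      dsimp
      rw [← Ext.mk₀_comp_mk₀_assoc, hp, Ext.comp_zero]) (add_comm 1 n)
    have : IsNoetherianObject (kernel (S.arrow ≫ p)) :=
      isNoetherianObject_of_mono (kernel.ι (S.arrow ≫ p))
    obtain ⟨P, hP, y, hy⟩ := ih z
    refine ⟨P, hP, hex.extClass.comp y (add_comm 1 n), ?_⟩
    rw [Ext.comp_assoc _ _ _ (add_comm 1 n) (add_zero n) (by lia), hy, ← hz,
      Ext.comp_assoc _ _ _ (add_comm 1 n) (add_zero n) (by lia)]

end Ext

/-! ### Linear algebra over skew fields, and the residue field. -/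

section DivisionRing

/-- Over a division ring, a linear map extends along any linear map with smaller kernel. -/
lemma exists_comp_eq_of_ker_le {R V W M : Type*} [Ring R] [Nontrivial R]
    (hR : ∀ a : R, IsUnit a ∨ a = 0) [AddCommGroup V] [Module R V] [AddCommGroup W] [Module R W]
    [AddCommGroup M] [Module R M] (i : V →ₗ[R] W) (φ : V →ₗ[R] M) (h : i.ker ≤ φ.ker) :
    ∃ ψ : W →ₗ[R] M, ψ.comp i = φ := by
  let := DivisionRing.ofIsUnitOrEqZero hR
  obtain ⟨g, hg⟩ := LinearMap.exists_leftInverse_of_injective (i.ker.liftQ i le_rfl)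
    (Submodule.ker_liftQ_eq_bot _ _ _ le_rfl)
  refine ⟨(i.ker.liftQ φ h).comp g, LinearMap.ext fun v => ?_⟩
  have hv : g (i v) = i.ker.mkQ v := LinearMap.congr_fun hg (i.ker.mkQ v)
  rw [LinearMap.comp_apply, LinearMap.comp_apply, hv]
  rfl

/-- Send a nonzero `x` to a nonzero `y` and extend from the line through `x`. -/
lemma exists_linearMap_ne_zero {R V M : Type*} [Ring R] [Nontrivial R]
    (hR : ∀ a : R, IsUnit a ∨ a = 0) [AddCommGroup V] [Module R V] [AddCommGroup M] [Module R M]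
    [Nontrivial V] [Nontrivial M] : ∃ φ : V →ₗ[R] M, φ ≠ 0 := by
  obtain ⟨x, hx⟩ := exists_ne (0 : V)
  obtain ⟨y, hy⟩ := exists_ne (0 : M)
  obtain ⟨ψ, hψ⟩ := exists_comp_eq_of_ker_le hR (LinearMap.toSpanSingleton R V x)
    (LinearMap.toSpanSingleton R M y) (by
      intro r hr
      rw [LinearMap.mem_ker, LinearMap.toSpanSingleton_apply] at hr ⊢
      rcases hR r with h | h
      · exact absurd (h.smul_eq_zero.1 hr) hx
      · rw [h, zero_smul])
  refine ⟨ψ, fun h => hy ?_⟩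
  have := LinearMap.congr_fun hψ 1
  simpa [h] using this.symm

end DivisionRing

namespace ResidueField

variable {H : MonoformObj A}

instance : Nontrivial (ResidueField H) := by
  obtain ⟨S⟩ : Nonempty (NonzeroSub H.obj) := inferInstance
  refine ⟨1, 0, fun h => ?_⟩
  rw [one_def S, ← mk_zero S, mk_eq_iff] at h
  obtain ⟨U, h, h', hU⟩ := h
  rw [NonzeroSub.incl_arrow, comp_zero] at hU
  exact U.ne_bot ((subobject_eq_bot_iff _).2 hU)

/-- A nonzero kernel would be a smaller index of the direct limit at which `f` becomes zero. -/
lemma mono_of_mk_ne_zero {S : NonzeroSub H.obj} {f : (S.sub : A) ⟶ H.obj} (hf : mk S f ≠ 0) :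
    Mono f := by
  by_contra hmono
  have hk : ¬ IsZero (kernel f) := fun h =>
    hmono (Preadditive.mono_of_kernel_zero (h.eq_of_src _ _))
  let T : NonzeroSub H.obj := ⟨Subobject.mk (kernel.ι f ≫ S.sub.arrow), mk_ne_bot _ hk⟩
  have hT : S ≤ T := Subobject.mk_le_of_comm (kernel.ι f) rfl
  have h : NonzeroSub.incl hT = (Subobject.underlyingIso _).hom ≫ kernel.ι f := by
    rw [← cancel_mono S.sub.arrow, NonzeroSub.incl_arrow]
    simp [T]
  apply hf
  rw [← mk_restrict hT, h, Category.assoc, kernel.condition, comp_zero, mk_zero]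

/-- The inverse is `f⁻¹`, defined on the image of the monomorphism `f`. -/
lemma exists_mul_eq_one {c : ResidueField H} (hc : c ≠ 0) : ∃ d, c * d = 1 := by
  obtain ⟨S, f, rfl⟩ := mk_surj c
  have := mono_of_mk_ne_zero hc
  let T : NonzeroSub H.obj :=
    ⟨Subobject.mk f, mk_ne_bot _ fun h => S.ne_bot ((isZero_coe_iff _).1 h)⟩
  refine ⟨mk T ((Subobject.underlyingIso f).hom ≫ S.sub.arrow), ?_⟩
  rw [mk_mul_mk f _ (le_refl T) (Subobject.underlyingIso f).hom (by simp), one_def T,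
    Subobject.underlyingIso_hom_comp_eq_mk]

/-- The residue field of an atom is a skew field. -/
lemma isUnit_or_eq_zero (c : ResidueField H) : IsUnit c ∨ c = 0 := by
  by_cases hc : c = 0
  · exact Or.inr hc
  obtain ⟨d, hd⟩ := exists_mul_eq_one hc
  have hd0 : d ≠ 0 := by
    rintro rfl
    rw [mul_zero] at hd
    exact zero_ne_one hd
  obtain ⟨e, he⟩ := exists_mul_eq_one hd0
  have hce : c = e := by rw [← mul_one c, ← he, ← mul_assoc, hd, one_mul]
  exact Or.inl ⟨⟨c, d, hd, hce ▸ he⟩, rfl⟩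

lemma isUnit_or_eq_zero_mulOpposite (c : (ResidueField H)ᵐᵒᵖ) : IsUnit c ∨ c = 0 := by
  rcases isUnit_or_eq_zero c.unop with h | h
  · exact Or.inl h.op
  · exact Or.inr (MulOpposite.unop_eq_zero_iff _ |>.1 h)

end ResidueField

/-! ### Comparing monoform objects of the same atom. -/

section Atom

lemma exists_mono_of_atom_eq {H K : MonoformObj A} (h : H.atom = K.atom) :
    ∃ (S : NonzeroSub K.obj) (m : (S.sub : A) ⟶ H.obj), Mono m := by
  obtain ⟨L₁, L₂, -, h₂, ⟨e⟩⟩ : AtomEquivalent H K := Quotient.exact h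
  exact ⟨⟨L₂, h₂⟩, e.inv ≫ L₁.arrow, inferInstance⟩

lemma NonzeroSub.not_isZero {X : A} (S : NonzeroSub X) : ¬ IsZero (S.sub : A) :=
  fun h => S.ne_bot ((isZero_coe_iff _).1 h)

instance NonzeroSub.mono_incl {X : A} {S T : NonzeroSub X} (h : S ≤ T) :
    Mono (NonzeroSub.incl h) :=
  mono_of_mono_fac (NonzeroSub.incl_arrow h)

end Atom

/-! ### Half exactness of `Ext^i(α, -)` and of its dual. -/

section AtomExt

open Abelian

variable [HasExt.{w} A] {H : MonoformObj A} {i : ℕ}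

/-- The canonical map `Ext^i(S, N) → Ext^i(α, N)`. -/
def atomExtMk {N : A} (S : NonzeroSub H.obj) (x : Ext.{w} (S.sub : A) N i) :
    AtomExt.{w} H i N :=
  Value.mk (F := (extFunctor.{w} i).flip.obj N) S x

lemma atomExtMk_surj {N : A} (z : AtomExt.{w} H i N) :
    ∃ (S : NonzeroSub H.obj) (x : Ext.{w} (S.sub : A) N i), z = atomExtMk S x :=
  Value.mk_surj z

lemma atomExtMk_zero {N : A} (S : NonzeroSub H.obj) :
    atomExtMk S (0 : Ext.{w} (S.sub : A) N i) = 0 :=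
  Value.mk_zero S

lemma atomExtMap_mk {N N' : A} (f : N ⟶ N') (S : NonzeroSub H.obj)
    (x : Ext.{w} (S.sub : A) N i) :
    atomExtMap H i f (atomExtMk S x) = atomExtMk S (x.comp (Ext.mk₀ f) (add_zero i)) := rfl

lemma atomExtMk_restrict {N : A} {S T : NonzeroSub H.obj} (h : S ≤ T)
    (x : Ext.{w} (S.sub : A) N i) :
    atomExtMk T ((Ext.mk₀ (NonzeroSub.incl h)).comp x (zero_add i)) = atomExtMk S x :=
  Value.mk_restrict (F := (extFunctor.{w} i).flip.obj N) h x

lemma exists_of_atomExtMk_eq_zero {N : A} {S : NonzeroSub H.obj} {x : Ext.{w} (S.sub : A) N i}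
    (hx : atomExtMk S x = 0) :
    ∃ (T : NonzeroSub H.obj) (h : S ≤ T),
      (Ext.mk₀ (NonzeroSub.incl h)).comp x (zero_add i) = 0 := by
  rw [← atomExtMk_zero S] at hx
  obtain ⟨T, h, h', e⟩ := Value.mk_eq_iff.1 hx
  exact ⟨T, h, e.trans (map_zero _)⟩

lemma atomExtMap_comp' {N N' N'' : A} (f : N ⟶ N') (g : N' ⟶ N'') :
    atomExtMap.{w} H i (f ≫ g) = (atomExtMap.{w} H i g).comp (atomExtMap.{w} H i f) :=
  LinearMap.ext fun z => atomExtMap_comp H i f g z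

lemma atomExtMap_id' (N : A) : atomExtMap.{w} H i (𝟙 N) = LinearMap.id :=
  LinearMap.ext fun z => atomExtMap_id H i N z

lemma atomExtMap_zero (N N' : A) : atomExtMap.{w} H i (0 : N ⟶ N') = 0 := by
  refine LinearMap.ext fun z => ?_
  obtain ⟨S, x, rfl⟩ := atomExtMk_surj z
  rw [atomExtMap_mk, Ext.mk₀_zero, Ext.comp_zero, atomExtMk_zero, LinearMap.zero_apply]

/-- `Ext^i(α, -)` is half exact. -/
lemma exists_atomExtMap_eq {S : ShortComplex A} (hS : S.ShortExact)
    (z : AtomExt.{w} H i S.X₂) (hz : atomExtMap H i S.g z = 0) :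
    ∃ y, atomExtMap H i S.f y = z := by
  obtain ⟨T, x, rfl⟩ := atomExtMk_surj z
  rw [atomExtMap_mk] at hz
  -- Vanishing in the direct limit already happens on some `U`, where the long exact sequence
  -- applies.
  obtain ⟨U, h, hU⟩ := exists_of_atomExtMk_eq_zero hz
  rw [← Ext.comp_assoc _ _ _ (zero_add i) (add_zero i) (by lia)] at hU
  obtain ⟨y, hy⟩ := Ext.covariant_sequence_exact₂ _ hS _ hU
  exact ⟨atomExtMk U y, by rw [← atomExtMk_restrict h x, ← hy, atomExtMap_mk]⟩

/-- The dual of `Ext^i(α, -)` is half exact. -/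
lemma exists_dual_comp_eq {S : ShortComplex A} (hS : S.ShortExact)
    (φ : DualAtomExt.{w} H i S.X₂) (hφ : φ.comp (atomExtMap H i S.f) = 0) :
    ∃ ψ : DualAtomExt.{w} H i S.X₃, ψ.comp (atomExtMap H i S.g) = φ := by
  refine exists_comp_eq_of_ker_le ResidueField.isUnit_or_eq_zero_mulOpposite _ φ fun z hz => ?_
  obtain ⟨y, rfl⟩ := exists_atomExtMap_eq hS z hz
  exact LinearMap.congr_fun hφ y

/-- This passes from the fixed representative `K` to an arbitrary monoform object `H` of the same
atom: the two share a nonzero subobject, and on a smaller one the class must vanish. -/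
lemma exists_mono_comp_eq_zero {K : MonoformObj A} (h : H.atom = K.atom) {N : A}
    (hK : ¬ Nontrivial (AtomExt.{w} K i N)) (x : Ext.{w} H.obj N i) :
    ∃ (Z : A) (m : Z ⟶ H.obj), Mono m ∧ ¬ IsZero Z ∧ (Ext.mk₀ m).comp x (zero_add i) = 0 := by
  rw [not_nontrivial_iff_subsingleton] at hK
  obtain ⟨S, m, _⟩ := exists_mono_of_atom_eq h
  obtain ⟨T, h, hT⟩ := exists_of_atomExtMk_eq_zero (H := K) (S := S)
    (x := (Ext.mk₀ m).comp x (zero_add i)) (hK.elim _ _)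
  rw [Ext.mk₀_comp_mk₀_assoc] at hT
  exact ⟨_, _, mono_comp _ _, T.not_isZero, hT⟩

/-- The analogue for the virtual dual, with `K'` as the fixed representative. -/
lemma exists_mono_dual_comp_eq_zero {K K' : MonoformObj A} (h : K.atom = K'.atom)
    (hK : ¬ Nontrivial (VirtualDualExt.{w} H i K')) (φ : DualAtomExt.{w} H i K.obj) :
    ∃ (Z : A) (m : Z ⟶ K.obj), Mono m ∧ ¬ IsZero Z ∧ φ.comp (atomExtMap H i m) = 0 := by
  rw [not_nontrivial_iff_subsingleton] at hK
  obtain ⟨S, m, _⟩ := exists_mono_of_atom_eq h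
  have e : (⟦⟨S, φ.comp (atomExtMap H i m)⟩⟧ : VirtualDualExt.{w} H i K') = ⟦⟨S, 0⟩⟧ :=
    hK.elim _ _
  obtain ⟨T, h, h', hT⟩ := Quotient.exact e
  refine ⟨_, NonzeroSub.incl h ≫ m, mono_comp _ _, T.not_isZero, ?_⟩
  rw [atomExtMap_comp']
  exact hT.trans (map_zero (dualTransition H i K' S T h'))

end AtomExt

/-! ### Maximal subobjects. -/

section Maximal

lemma not_isZero_cokernel_arrow {X : A} {L : Subobject X} (h : ¬ IsIso L.arrow) :
    ¬ IsZero (cokernel L.arrow) := fun hz => h <| by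
  have : Epi L.arrow := Preadditive.epi_of_cokernel_zero (hz.eq_of_tgt _ _)
  exact isIso_of_mono_of_epi _

lemma shortExact_cokernel_arrow {X : A} (L : Subobject X) :
    (ShortComplex.mk L.arrow (cokernel.π L.arrow) (cokernel.condition _)).ShortExact :=
  ⟨ShortComplex.exact_cokernel _⟩

lemma exists_maximal_of_isNoetherianObject {X : A} [IsNoetherianObject X]
    (p : Subobject X → Prop) (h : p ⊥) : ∃ L, Maximal p L := by
  obtain ⟨L, hL, hmax⟩ := WellFounded.has_min (wellFounded_gt (α := Subobject X)) {L | p L} ⟨⊥, h⟩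
  exact ⟨L, hL, fun L' hL' hle => by
    by_contra hne
    exact hmax L' hL' (lt_of_le_not_ge hle hne)⟩

/-- The preimage in `X` of a nonzero subobject of `X / L` is not contained in `L`. -/
lemma not_mk_pullback_fst_le {X Z : A} {L : Subobject X} (m : Z ⟶ cokernel L.arrow) [Mono m]
    (hZ : ¬ IsZero Z) : ¬ Subobject.mk (pullback.fst (cokernel.π L.arrow) m) ≤ L := by
  intro h
  have h₁ : L.Factors (pullback.fst (cokernel.π L.arrow) m) := Subobject.factors_of_le _ h
    ((Subobject.mk_factors_iff _ _).2 ⟨𝟙 _, Category.id_comp _⟩)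
  rw [factors_iff_comp_cokernel_π, pullback.condition] at h₁
  have h₂ : m = 0 := (cancel_epi (pullback.snd (cokernel.π L.arrow) m)).1 (by rw [h₁, comp_zero])
  exact hZ ((IsZero.iff_id_eq_zero _).2 ((cancel_mono m).1 (by rw [h₂, comp_zero, comp_zero])))

lemma le_mk_pullback_fst {X Z : A} {L : Subobject X} (m : Z ⟶ cokernel L.arrow) [Mono m] :
    L ≤ Subobject.mk (pullback.fst (cokernel.π L.arrow) m) :=
  Subobject.le_mk_of_comm (pullback.lift L.arrow 0 (by simp)) (pullback.lift_fst _ _ _)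

/-- There is a maximal subobject of `E` on which `p` is a monomorphism. -/
lemma exists_maximal_mono_comp [IsGrothendieckAbelian.{v} A] (hA : HasEnoughNoetherian A) {E M : A}
    (p : E ⟶ M) :
    ∃ P, Maximal (fun P : Subobject E => Mono (P.arrow ≫ p)) P := by
  refine zorn_le₀ {P : Subobject E | Mono (P.arrow ≫ p)} fun c hcs hc => ?_
  rcases c.eq_empty_or_nonempty with rfl | hne
  · refine ⟨⊥, Preadditive.mono_of_cancel_zero _ fun g _ => ?_, by simp⟩
    exact ((isZero_coe_iff _).2 rfl).eq_of_tgt _ _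
  refine ⟨sSup c, Preadditive.mono_of_cancel_zero _ fun {W} a ha => ?_, fun P hP => le_sSup hP⟩
  by_contra ha0
  -- A nonzero kernel on the union would be visible on a noetherian `U`, hence inside a single
  -- member of the chain, where `p` is a monomorphism.
  obtain ⟨U, _, g, hg⟩ := hA a ha0
  obtain ⟨P, hP, hf⟩ := exists_factors_of_isChain hc hne (g ≫ a ≫ (sSup c).arrow)
    (by rw [← Category.assoc]; exact Subobject.factors_comp_arrow _)
  obtain ⟨b, hb⟩ := (exists_factors_iff _ _).1 hf
  have : Mono (P.arrow ≫ p) := hcs hP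
  have hb0 : b = 0 := by
    rw [← cancel_mono (P.arrow ≫ p), zero_comp, ← Category.assoc, hb]
    simp only [Category.assoc, ha, comp_zero]
  apply hg
  rw [← cancel_mono (sSup c).arrow, zero_comp, Category.assoc, ← hb, hb0, zero_comp]

end Maximal

open Abelian

variable [HasExt.{w} A]

/-! ### From `Ext^i(α, N)` to the virtual dual. -/

section SecondVariable

/-- If the virtual duals vanished, the functional induced on `N / L` would vanish on a nonzero
subobject, whose preimage in `N` would contradict the maximality of `L`. -/
lemma exists_virtualDualExt_of_maximal (hA : HasEnoughNoetherian A) (ρ : Representatives A)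
    {H : MonoformObj A} {i : ℕ} {N : A} {φ : DualAtomExt.{w} H i N} (hφ : φ ≠ 0)
    {L : Subobject N}
    (hL : Maximal (fun L : Subobject N => φ.comp (atomExtMap H i L.arrow) = 0) L) :
    ∃ β ∈ aSupp N, Nontrivial (VirtualDualExt.{w} H i (ρ.rep β)) := by
  by_contra! hβ
  obtain ⟨ψ, hψ⟩ := exists_dual_comp_eq (shortExact_cokernel_arrow L) φ hL.1
  dsimp only at hψ
  have hiso : ¬ IsIso L.arrow := fun _ => hφ <| by
    have h : φ.comp ((atomExtMap H i L.arrow).comp (atomExtMap H i (inv L.arrow))) = φ := by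
      rw [← atomExtMap_comp', IsIso.inv_hom_id, atomExtMap_id', LinearMap.comp_id]
    rw [← h, ← LinearMap.comp_assoc, hL.1, LinearMap.zero_comp]
  obtain ⟨K, k, _⟩ := hA.exists_monoform (not_isZero_cokernel_arrow hiso)
  have hK : K.atom ∈ aSupp N :=
    aSupp_subset_of_epi (cokernel.π L.arrow) (MonoformObj.atom_mem_aSupp k)
  obtain ⟨Z, m, _, hZ, hm⟩ := exists_mono_dual_comp_eq_zero (ρ.atom_rep K.atom).symm
    (not_nontrivial_iff_subsingleton.2 (hβ _ hK)) (ψ.comp (atomExtMap H i k))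
  refine not_mk_pullback_fst_le (m ≫ k) hZ (hL.2 ?_ (le_mk_pullback_fst (m ≫ k)))
  have h : (Subobject.mk (pullback.fst (cokernel.π L.arrow) (m ≫ k))).arrow ≫ cokernel.π L.arrow =
      ((Subobject.underlyingIso _).hom ≫ pullback.snd (cokernel.π L.arrow) (m ≫ k)) ≫ m ≫ k := by
    rw [Category.assoc, ← pullback.condition, ← Category.assoc,
      Subobject.underlyingIso_hom_comp_eq_mk]
  dsimp only
  rw [← hψ, LinearMap.comp_assoc, ← atomExtMap_comp', h, atomExtMap_comp', atomExtMap_comp',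
    ← LinearMap.comp_assoc, ← LinearMap.comp_assoc, hm, LinearMap.zero_comp]

lemma exists_maximal_dual_of_isGrothendieckAbelian [IsGrothendieckAbelian.{v} A]
    (hA : HasEnoughNoetherian A) {H : MonoformObj A} {i : ℕ} {N : A}
    (φ : DualAtomExt.{w} H i N) :
    ∃ L, Maximal (fun L : Subobject N => φ.comp (atomExtMap H i L.arrow) = 0) L := by
  refine zorn_le₀ {L : Subobject N | φ.comp (atomExtMap H i L.arrow) = 0} fun c hcs hc => ?_
  rcases c.eq_empty_or_nonempty with rfl | hne
  · refine ⟨⊥, ?_, by simp⟩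
    rw [Set.mem_ofPred_eq, Subobject.bot_arrow, atomExtMap_zero, LinearMap.comp_zero]
  refine ⟨sSup c, LinearMap.ext fun z => ?_, fun P hP => le_sSup hP⟩
  obtain ⟨S, x, rfl⟩ := atomExtMk_surj z
  -- Restricting to a noetherian subobject of `S` does not change the class in the direct limit, and
  -- makes the result on chains applicable.
  obtain ⟨T, hT, hT0⟩ := hA.exists_noetherian_ne_bot S.not_isZero
  let U : NonzeroSub H.obj := ⟨Subobject.mk (T.arrow ≫ S.sub.arrow),
    mk_ne_bot _ fun h => hT0 ((isZero_coe_iff T).1 h)⟩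
  have hSU : S ≤ U := Subobject.mk_le_of_comm T.arrow rfl
  have : IsNoetherianObject (U.sub : A) :=
    isNoetherianObject_of_mono (Subobject.underlyingIso (T.arrow ≫ S.sub.arrow)).hom
  obtain ⟨P, hP, y, hy⟩ := exists_ext_of_isChain hA hc hne i
    ((Ext.mk₀ (NonzeroSub.incl hSU)).comp x (zero_add i))
  rw [← atomExtMk_restrict hSU, LinearMap.comp_apply, atomExtMap_mk, ← hy, ← atomExtMap_mk]
  exact LinearMap.congr_fun (hcs hP) (atomExtMk U y)

lemma exists_virtualDualExt_of_atomExt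
    (hA : IsLocallyNoetherianGrothendieck A ∨ IsNoetherianAbelian A) (ρ : Representatives A)
    (H : MonoformObj A) (i : ℕ) (N : A) (h : Nontrivial (AtomExt.{w} H i N)) :
    ∃ β ∈ aSupp N, Nontrivial (VirtualDualExt.{w} H i (ρ.rep β)) := by
  obtain ⟨φ, hφ⟩ : ∃ φ : DualAtomExt.{w} H i N, φ ≠ 0 :=
    exists_linearMap_ne_zero ResidueField.isUnit_or_eq_zero_mulOpposite
  rcases hA with hA | hA
  · have := hA.1
    obtain ⟨L, hL⟩ := exists_maximal_dual_of_isGrothendieckAbelian hA.hasEnoughNoetherian φ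
    exact exists_virtualDualExt_of_maximal hA.hasEnoughNoetherian ρ hφ hL
  · have := hA.1 N
    obtain ⟨L, hL⟩ := exists_maximal_of_isNoetherianObject
      (fun L : Subobject N => φ.comp (atomExtMap H i L.arrow) = 0)
      (by rw [Subobject.bot_arrow, atomExtMap_zero, LinearMap.comp_zero])
    exact exists_virtualDualExt_of_maximal hA.hasEnoughNoetherian ρ hφ hL

end SecondVariable

/-! ### From `Ext^i(M, N)` to `Ext^i(α, N)`. -/

section FirstVariable

/-- The maximality argument applied to the largest `L` on which `x` restricts to zero: `x` comes
from `M / L`, and its pullback to a monoform subobject there dies on a smaller nonzero subobject. -/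
lemma ext_eq_zero_of_isNoetherianObject (ρ : Representatives A) {i : ℕ} {M N : A}
    [IsNoetherianObject M] (h : ∀ α ∈ aSupp M, ¬ Nontrivial (AtomExt.{w} (ρ.rep α) i N))
    (x : Ext.{w} M N i) : x = 0 := by
  obtain ⟨L, hL⟩ := exists_maximal_of_isNoetherianObject
    (fun L : Subobject M => (Ext.mk₀ L.arrow).comp x (zero_add i) = 0)
    (by rw [Subobject.bot_arrow, Ext.mk₀_zero, Ext.zero_comp])
  by_cases hiso : IsIso L.arrow
  · rw [← Ext.mk₀_id_comp x, ← IsIso.inv_hom_id L.arrow, ← Ext.mk₀_comp_mk₀_assoc, hL.1,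
      Ext.comp_zero]
  exfalso
  obtain ⟨y, hy⟩ := Ext.contravariant_sequence_exact₂ (shortExact_cokernel_arrow L) N x hL.1
  dsimp only at y hy
  have : IsNoetherianObject (cokernel L.arrow) := isNoetherianObject_of_epi (cokernel.π L.arrow)
  obtain ⟨K, k, _⟩ := exists_monoform_of_isNoetherianObject (not_isZero_cokernel_arrow hiso)
  have hK : K.atom ∈ aSupp M :=
    aSupp_subset_of_epi (cokernel.π L.arrow) (MonoformObj.atom_mem_aSupp k)
  obtain ⟨Z, m, _, hZ, hm⟩ := exists_mono_comp_eq_zero (ρ.atom_rep K.atom).symm (h _ hK)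
    ((Ext.mk₀ k).comp y (zero_add i))
  refine not_mk_pullback_fst_le (m ≫ k) hZ (hL.2 ?_ (le_mk_pullback_fst (m ≫ k)))
  rw [Ext.mk₀_comp_mk₀_assoc] at hm
  rw [← hy, Ext.mk₀_comp_mk₀_assoc, ← Subobject.underlyingIso_hom_comp_eq_mk, Category.assoc,
    pullback.condition, ← Category.assoc, ← Ext.mk₀_comp_mk₀_assoc, hm, Ext.comp_zero]

variable [IsGrothendieckAbelian.{v} A]

/-- A Baer criterion: if `Ext^1(H, Q)` vanishes for all noetherian subquotients `H` of `M`, then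
`Ext^1(M, Q)` vanishes. -/
lemma ext_one_eq_zero_of_subquotients (hA : HasEnoughNoetherian A) {M Q : A}
    (h : ∀ ⦃B H : A⦄ (q : M ⟶ B) (m : H ⟶ B) [Epi q] [Mono m] [IsNoetherianObject H]
      (y : Ext.{w} H Q 1), y = 0) (x : Ext.{w} M Q 1) : x = 0 := by
  have hS : (ShortComplex.mk (Injective.ι Q) (cokernel.π (Injective.ι Q))
    (cokernel.condition _)).ShortExact := ⟨ShortComplex.exact_cokernel _⟩
  obtain ⟨y, hy⟩ := Ext.covariant_sequence_exact₁ M hS x (Ext.eq_zero_of_injective _) (zero_add 1)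
  obtain ⟨f, rfl⟩ := (Ext.mk₀_bijective _ _).2 y
  dsimp only at f hy
  let π := cokernel.π (Injective.ι Q)
  -- The pullback of `f` and `π` is the extension of `M` by `Q` with class `x`. A subobject mapping
  -- monomorphically to `M` is a partial splitting, that is, a lift `s` of `f` to the injective
  -- object over the subobject `l`. A maximal one will be shown to be defined on all of `M`.
  obtain ⟨P, hP⟩ := exists_maximal_mono_comp hA (pullback.fst f π)
  let l := P.arrow ≫ pullback.fst f π
  have : Mono l := hP.1
  let s := P.arrow ≫ pullback.snd f π
  have hls : l ≫ f = s ≫ π := by simp only [l, s, Category.assoc, pullback.condition]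
  have hlx : (Ext.mk₀ l).comp x (zero_add 1) = 0 := by
    rw [← hy, Ext.mk₀_comp_mk₀_assoc, hls, ← Ext.mk₀_comp_mk₀_assoc, hS.comp_extClass,
      Ext.comp_zero]
  by_cases hl : Epi l
  · have : IsIso l := isIso_of_mono_of_epi l
    rw [← Ext.mk₀_id_comp x, ← IsIso.inv_hom_id l, ← Ext.mk₀_comp_mk₀_assoc, hlx, Ext.comp_zero]
  exfalso
  have hB : ¬ IsZero (cokernel l) := fun hz =>
    hl (Preadditive.epi_of_cokernel_zero (hz.eq_of_tgt _ _))
  obtain ⟨T, _, hT⟩ := hA.exists_noetherian_ne_bot hB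
  let q := cokernel.π l
  let j := pullback.fst q T.arrow
  let v := pullback.snd q T.arrow
  have hjv : j ≫ q = v ≫ T.arrow := pullback.condition
  -- The preimage of `T` in `M` is an extension of `T` by `P`, to which the splitting is to be
  -- extended.
  let k : (P : A) ⟶ pullback q T.arrow := pullback.lift l 0 (by simp [q])
  have hkj : k ≫ j = l := pullback.lift_fst _ _ _
  have hkv : k ≫ v = 0 := pullback.lift_snd _ _ _
  have : Mono k := mono_of_mono_fac hkj
  have hS' : (ShortComplex.mk k v hkv).ShortExact := by
    refine ⟨(ShortComplex.exact_iff_exact_up_to_refinements _).2 fun W a ha => ?_⟩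
    dsimp only at a ha
    have h0 : (a ≫ j) ≫ cokernel.π l = 0 := by
      rw [Category.assoc, hjv, ← Category.assoc, ha, zero_comp]
    refine ⟨W, 𝟙 W, inferInstance, Abelian.monoLift l (a ≫ j) h0, ?_⟩
    rw [Category.id_comp, ← cancel_mono j, Category.assoc, hkj, Abelian.monoLift_comp]
  obtain ⟨z, hz⟩ := Ext.contravariant_sequence_exact₂ hS' Q
    ((Ext.mk₀ j).comp x (zero_add 1)) (by rw [Ext.mk₀_comp_mk₀_assoc, hkj, hlx])
  -- The restriction of `x` to the preimage vanishes on `P`, so it comes from `Ext^1(T, Q) = 0`.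
  -- Hence `f` lifts over the preimage to some `s'`.
  have hjx : (Ext.mk₀ (j ≫ f)).comp hS.extClass (zero_add 1) = 0 := by
    rw [← Ext.mk₀_comp_mk₀_assoc, hy, ← hz, h q T.arrow z, Ext.comp_zero]
  obtain ⟨s', hs'⟩ := Ext.covariant_sequence_exact₃ _ hS _ _ hjx
  obtain ⟨s', rfl⟩ := (Ext.mk₀_bijective _ _).2 s'
  rw [Ext.mk₀_comp_mk₀] at hs'
  replace hs' : s' ≫ π = j ≫ f := (Ext.mk₀_bijective _ _).1 hs'
  have hd : (k ≫ s' - s) ≫ cokernel.π (Injective.ι Q) = 0 := by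
    rw [Preadditive.sub_comp, Category.assoc, hs', ← Category.assoc, hkj, hls, sub_self]
  -- On `P` the lifts `s'` and `s` differ by a map `d` to `Q`. The obstruction to extending `d` to
  -- the preimage also lies in `Ext^1(T, Q) = 0`, so `s'` can be corrected to extend `s`.
  let d := Abelian.monoLift (Injective.ι Q) (k ≫ s' - s) hd
  have hdι : d ≫ Injective.ι Q = k ≫ s' - s := Abelian.monoLift_comp _ _ _
  obtain ⟨d', hd'⟩ := Ext.contravariant_sequence_exact₁ hS' Q (Ext.mk₀ d) (add_zero 1)
    (h q T.arrow _)
  obtain ⟨d', rfl⟩ := (Ext.mk₀_bijective _ _).2 d'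
  rw [Ext.mk₀_comp_mk₀] at hd'
  replace hd' : k ≫ d' = d := (Ext.mk₀_bijective _ _).1 hd'
  have hr : j ≫ f = (s' - d' ≫ Injective.ι Q) ≫ π := by
    rw [Preadditive.sub_comp, Category.assoc, cokernel.condition, comp_zero, sub_zero, hs']
  let r := pullback.lift j (s' - d' ≫ Injective.ι Q) hr
  have hrj : r ≫ pullback.fst f π = j := pullback.lift_fst _ _ _
  have hkr : k ≫ r = P.arrow := by
    apply pullback.hom_ext
    · rw [Category.assoc, hrj, hkj]
    · rw [Category.assoc, pullback.lift_snd, Preadditive.comp_sub, ← Category.assoc, hd', hdι]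
      exact sub_sub_cancel _ _
  have : Mono r := mono_of_mono_fac hrj
  have hle : Subobject.mk r ≤ P := hP.2 (by
    have : (Subobject.mk r).arrow ≫ pullback.fst f π = (Subobject.underlyingIso r).hom ≫ j := by
      rw [← Subobject.underlyingIso_hom_comp_eq_mk, Category.assoc, hrj]
    dsimp only
    rw [this]
    exact mono_comp _ _) (Subobject.le_mk_of_comm k hkr)
  obtain ⟨b, hb⟩ := (exists_factors_iff _ _).1 (Subobject.factors_of_le r hle
    ((Subobject.mk_factors_iff _ _).2 ⟨𝟙 _, Category.id_comp _⟩))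
  have hjl : j = b ≫ l := by rw [← hrj, ← hb, Category.assoc]
  have hvT : v ≫ T.arrow = 0 := by
    rw [← hjv, hjl, Category.assoc, cokernel.condition, comp_zero]
  apply hT
  rw [subobject_eq_bot_iff]
  exact (cancel_epi v).1 (by rw [hvT, comp_zero])

/-- Dimension shifting in `N`: both the hypothesis and the conclusion pass to the cokernel of an
injective embedding. It stops at degree one because morphisms into an injective object need not
vanish. -/
lemma ext_succ_eq_zero_of_subquotients (hA : HasEnoughNoetherian A) (n : ℕ) {M N : A}
    (h : ∀ ⦃B H : A⦄ (q : M ⟶ B) (m : H ⟶ B) [Epi q] [Mono m] [IsNoetherianObject H]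
      (y : Ext.{w} H N (n + 1)), y = 0) (x : Ext.{w} M N (n + 1)) : x = 0 := by
  induction n generalizing N with
  | zero => exact ext_one_eq_zero_of_subquotients hA h x
  | succ n ih =>
    have hS : (ShortComplex.mk (Injective.ι N) (cokernel.π (Injective.ι N))
      (cokernel.condition _)).ShortExact := ⟨ShortComplex.exact_cokernel _⟩
    obtain ⟨y, hy⟩ := Ext.covariant_sequence_exact₁ M hS x (Ext.eq_zero_of_injective _) rfl
    rw [← hy, ih (fun B H q m _ _ _ z => ?_) y, Ext.zero_comp]
    obtain ⟨t, ht⟩ := Ext.covariant_sequence_exact₃ _ hS z rfl (h q m _)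
    rw [← ht, Ext.eq_zero_of_injective t, Ext.zero_comp]

/-- In degree zero a nonzero morphism stays nonzero on a noetherian subobject. In positive degree
the Baer criterion reduces to noetherian subquotients, whose atom support lies in that of `M`. -/
lemma ext_eq_zero_of_hasEnoughNoetherian (hA : HasEnoughNoetherian A) (ρ : Representatives A)
    (i : ℕ) {M N : A} (h : ∀ α ∈ aSupp M, ¬ Nontrivial (AtomExt.{w} (ρ.rep α) i N))
    (x : Ext.{w} M N i) : x = 0 := by
  cases i with
  | zero =>
    obtain ⟨f, rfl⟩ := (Ext.mk₀_bijective _ _).2 x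
    by_contra hf
    obtain ⟨S, _, hS⟩ := hA.exists_subobject f (fun h => hf (by rw [h, Ext.mk₀_zero]))
    exact hS ((Ext.mk₀_eq_zero_iff _).1 (ext_eq_zero_of_isNoetherianObject ρ
      (fun α hα => h α (aSupp_subset_of_mono S.arrow hα)) _))
  | succ n =>
    exact ext_succ_eq_zero_of_subquotients hA n (fun B H q m _ _ _ y =>
      ext_eq_zero_of_isNoetherianObject ρ
        (fun α hα => h α (aSupp_subset_of_epi q (aSupp_subset_of_mono m hα))) y) x

end FirstVariable

/-! ### Assembling the two variables and the global dimension. -/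

lemma exists_atomExt_of_ext
    (hA : IsLocallyNoetherianGrothendieck A ∨ IsNoetherianAbelian A) (ρ : Representatives A)
    (i : ℕ) (M N : A) (h : Nontrivial (Ext.{w} M N i)) :
    ∃ α ∈ aSupp M, Nontrivial (AtomExt.{w} (ρ.rep α) i N) := by
  by_contra! hα
  simp only [← not_nontrivial_iff_subsingleton] at hα
  obtain ⟨x, hx⟩ := exists_ne (0 : Ext.{w} M N i)
  apply hx
  rcases hA with hA | hA
  · have := hA.1
    exact ext_eq_zero_of_hasEnoughNoetherian hA.hasEnoughNoetherian ρ i hα x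
  · have := hA.1 M
    exact ext_eq_zero_of_isNoetherianObject ρ hα x

lemma exists_ext_of_virtualDualExt {H K : MonoformObj A} {i : ℕ}
    (h : Nontrivial (VirtualDualExt.{w} H i K)) :
    ∃ M N : A, Nontrivial (Ext.{w} M N i) := by
  by_contra! hE
  have hV : ∀ S : NonzeroSub K.obj, Subsingleton (DualAtomExt.{w} H i (S.sub : A)) := by
    intro S
    refine ⟨fun φ ψ => LinearMap.ext fun z => ?_⟩
    obtain ⟨T, x, rfl⟩ := atomExtMk_surj z
    have hx : x = 0 := (hE _ _).elim _ _
    rw [hx, atomExtMk_zero, map_zero, map_zero]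
  refine not_subsingleton_iff_nontrivial.2 h ⟨fun a b => ?_⟩
  induction a using Quotient.inductionOn with | _ a
  induction b using Quotient.inductionOn with | _ b
  obtain ⟨U, h₁, h₂⟩ := exists_ge_ge a.1 b.1
  exact Quotient.sound ⟨U, h₁, h₂, (hV U).elim _ _⟩

end AtomSpectrum

end

theorem corollary4 {A : Type u} [Category.{v} A] [Abelian A] [HasExt.{w} A]
    (hA : AtomSpectrum.IsLocallyNoetherianGrothendieck A ∨ AtomSpectrum.IsNoetherianAbelian A)
    (ρ : AtomSpectrum.Representatives A) :
    (∀ (i : ℕ) (α : AtomSpectrum.ASpec A) (N : A),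
      Nontrivial (AtomSpectrum.AtomExt.{w} (ρ.rep α) i N) →
        ∃ β ∈ AtomSpectrum.aSupp N,
          Nontrivial (AtomSpectrum.VirtualDualExt.{w} (ρ.rep α) i (ρ.rep β))) ∧
    (∀ (i : ℕ) (M N : A), Nontrivial (Abelian.Ext.{w} M N i) →
        ∃ α ∈ AtomSpectrum.aSupp M, ∃ β ∈ AtomSpectrum.aSupp N,
          Nontrivial (AtomSpectrum.VirtualDualExt.{w} (ρ.rep α) i (ρ.rep β))) ∧
    AtomSpectrum.globalDimension.{w} A =
      sSup {d : WithBot ℕ∞ | ∃ i : ℕ, d = (i : WithBot ℕ∞) ∧ ∃ α β : AtomSpectrum.ASpec A,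
        Nontrivial (AtomSpectrum.VirtualDualExt.{w} (ρ.rep α) i (ρ.rep β))} := by
  have h₁ := fun (i : ℕ) (α : AtomSpectrum.ASpec A) (N : A) =>
    AtomSpectrum.exists_virtualDualExt_of_atomExt.{w} hA ρ (ρ.rep α) i N
  have h₂ : ∀ (i : ℕ) (M N : A), Nontrivial (Abelian.Ext.{w} M N i) →
      ∃ α ∈ AtomSpectrum.aSupp M, ∃ β ∈ AtomSpectrum.aSupp N,
        Nontrivial (AtomSpectrum.VirtualDualExt.{w} (ρ.rep α) i (ρ.rep β)) := by
    intro i M N h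
    obtain ⟨α, hα, h⟩ := AtomSpectrum.exists_atomExt_of_ext hA ρ i M N h
    exact ⟨α, hα, h₁ i α N h⟩
  -- The two sets of degrees coincide, not merely their suprema.
  refine ⟨h₁, h₂, congrArg sSup
    (Set.ext fun d => exists_congr fun i => and_congr_right fun _ => ?_)⟩
  constructor
  · rintro ⟨M, N, h⟩
    obtain ⟨α, -, β, -, h⟩ := h₂ i M N h
    exact ⟨α, β, h⟩
  · rintro ⟨α, β, h⟩
    exact AtomSpectrum.exists_ext_of_virtualDualExt h
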